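/- Let $\Omega=(a,b)$, $r\ge 1$, and consider $-(\alpha u')'+\beta u'+\gamma u=f$ in $\Omega$, $u(a)=u(b)=0$, where, for some constants $\alpha_0,\kappa,\Lambda$ with $\alpha_0,\kappa>0$: $\alpha,\gamma$ are measurable, $\beta$ is absolutely continuous on $[a,b]$, $\alpha_0\le\alpha\le\Lambda$ and $|\beta|\le\Lambda$ on $\Omega$, and $|\gamma|\le\Lambda$ and $\gamma-\tfrac12\beta'\ge\kappa$ a.e. in $\Omega$. A solution is a $u\in H^1_0(\Omega)$ whose flux $\alpha u'$ agrees, at every point of $\Omega$ where $u$ is differentiable, with an absolutely continuous function $q$ on $[a,b]$ such that $-q'+\beta u'+\gamma u=f$ a.e. Let ${\mathcal P}$ be a partition $a=x_0<\dots<x_N=b$, $N\ge1$, $\tau_i=[x_{i-1},x_i]$, $h_i=x_i-x_{i-1}$, $h=\max_i h_i$. Let $G_1<\dots<G_r$ be the zeros of the Legendre polynomial $P_r$, let $L_0=-1$, $L_r=1$ and let $L_1<\dots<L_{r-1}$ be the zeros of $P_r'$; put $g_{i,j}=\frac12(x_i+x_{i-1}+h_iG_j)$ for $1\le j\le r$,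 $g_{i,r+1}=g_{i+1,1}$ for $i<N$, and $l_{i,j}=\frac12(x_i+x_{i-1}+h_iL_j)$ for $0\le j\le r$. Let $U^r_{\mathcal P}$ be the space of continuous functions on $[a,b]$ that vanish at $a,b$ and are polynomials of degree $\le r$ on each $\tau_i$. Put $r_i=r$ for $i<N$ and $r_N=r-1$, and let $V_{{\mathcal P}'}$ be the space of functions $w=\sum_{i=1}^N\sum_{j=1}^{r_i}w_{i,j}\chi_{[g_{i,j},g_{i,j+1}]}$, $w_{i,j}\in\mathbb R$. With $w_{1,0}=w_{N,r}=0$, $w_{i,0}=w_{i-1,r}$ for $i\ge 2$, and $[w_{i,j}]=w_{i,j}-w_{i,j-1}$, put $$\|w\|_{{\mathcal P}'}^2=\sum_{i=1}^N\sum_{j=1}^r h_i^{-1}[w_{i,j}]^2+\sum_{i=1}^N\sum_{j=1}^{r_i}h_iw_{i,j}^2,$$ $$a_{\mathcal P}(v,w)=\sum_{i=1}^N\sum_{j=1}^r[w_{i,j}]\,\alpha(g_{i,j})v'(g_{i,j})+\sum_{i=1}^N\sum_{j=1}^{r_i}w_{i,j}\int_{g_{i,j}}^{g_{i,j+1}}(\beta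 v'+\gamma v)\,dx .$$ The finite volume scheme is: find $u_{\mathcal P}\in U^r_{\mathcal P}$ with $a_{\mathcal P}(u_{\mathcal P},w)=\int_a^b f\,w\,dx$ for all $w\in V_{{\mathcal P}'}$. For $u$ continuous on $[a,b]$, $u_I\in U^r_{\mathcal P}$ denotes the interpolant with $u_I(l_{i,j})=u(l_{i,j})$ for all $i,j$; $H^{m}_{\mathcal P}$ is the space of continuous functions on $[a,b]$ whose restriction to each $\tau_i$ is in $H^m(\tau_i)$; $|u|_{m,{\mathcal P}}^2=\sum_i\|u^{(m)}\|_{L^2(\tau_i)}^2$ and $|u|_{m,\infty,{\mathcal P}}=\max_i\|u^{(m)}\|_{L^\infty(\tau_i)}$. **Theorem.** There are constants $C,h_0>0$, depending only on $r,a,b,\alpha_0,\kappa,\Lambda$ (in particular not on ${\mathcal P}$, $u$, $f$ or $w$), such that for all such coefficients and all partitions ${\mathcal P}$ the following holds. For every $u\in H^1_0(\Omega)\cap H^{r+2}_{\mathcal P}$, $$|a_{\mathcal P}(u-u_I,w)|\le C\,h^{r+1}\left(|u|_{r+2,{\mathcal P}}+|u|_{r+1,\infty,{\mathcal P}}\right)\|w\|_{{\mathcal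 P}'}\qquad\text{for all } w\in V_{{\mathcal P}'} .$$ If moreover $u$ is a solution of the boundary value problem with right-hand side $f$, $u_{\mathcal P}$ is a solution of the finite volume scheme with the same $f$, and $h\le h_0$, then $$\|u_I-u_{\mathcal P}\|_{H^1(\Omega)}\le C\,h^{r+1}\left(|u|_{r+2,{\mathcal P}}+|u|_{r+1,\infty,{\mathcal P}}\right).$$ -/

import Mathlib

open MeasureTheory
open scoped ENNReal

noncomputable section

namespace FVM

/-! ### Sobolev spaces on a compact interval -/

/-- `v ∈ W^{m,p}(c,d)`, for the continuous representative `v` on `[c,d]`: the derivatives of order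
`< m` are absolutely continuous on `[c,d]`, and the derivatives of order `≤ m` are in `L^p`. -/
def MemW (m : ℕ) (p : ℝ≥0∞) (c d : ℝ) (v : ℝ → ℝ) : Prop :=
  (∀ j < m, AbsolutelyContinuousOnInterval (iteratedDerivWithin j v (Set.Icc c d)) c d) ∧
    ∀ j ≤ m, MemLp (iteratedDerivWithin j v (Set.Icc c d)) p (volume.restrict (Set.Icc c d))

/-- The seminorm `|v|_{j,p,(c,d)} = ‖v^{(j)}‖_{L^p(c,d)}`. -/
def semi (j : ℕ) (p : ℝ≥0∞) (c d : ℝ) (v : ℝ → ℝ) : ℝ :=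
  (eLpNorm (iteratedDerivWithin j v (Set.Icc c d)) p (volume.restrict (Set.Icc c d))).toReal

/-- `v ∈ H^1_0(a,b)`. -/
def MemH10 (a b : ℝ) (v : ℝ → ℝ) : Prop :=
  MemW 1 2 a b v ∧ v a = 0 ∧ v b = 0

/-- The norm `‖v‖_1` of `H^1(a,b)`. -/
def normH1 (a b : ℝ) (v : ℝ → ℝ) : ℝ :=
  Real.sqrt (semi 0 2 a b v ^ 2 + semi 1 2 a b v ^ 2)

/-! ### The boundary value problem -/

/-- The coefficients of `-(α u')' + β u' + γ u = f` on `(a,b)`: `α ≥ α₀`, `γ - β'/2 ≥ κ`, and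
`Λ` bounds `|α|`, `|β|`, `|γ|`. -/
structure Coefficients (a b α₀ κ Λ : ℝ) (α β γ : ℝ → ℝ) : Prop where
  α_meas : AEStronglyMeasurable α (volume.restrict (Set.Icc a b))
  α_lower : ∀ x ∈ Set.Ioo a b, α₀ ≤ α x
  α_upper : ∀ x ∈ Set.Ioo a b, α x ≤ Λ
  β_ac : AbsolutelyContinuousOnInterval β a b
  β_bound : ∀ x ∈ Set.Ioo a b, |β x| ≤ Λ
  γ_meas : AEStronglyMeasurable γ (volume.restrict (Set.Icc a b))
  γ_bound : ∀ᵐ x ∂(volume.restrict (Set.Icc a b)), |γ x| ≤ Λ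
  coercive : ∀ᵐ x ∂(volume.restrict (Set.Icc a b)), κ ≤ γ x - deriv β x / 2

/-- `u ∈ H^1_0(a,b)` solves `-(α u')' + β u' + γ u = f`, `u(a) = u(b) = 0`: the flux `α u'`
(defined where `u` is differentiable) is given by an absolutely continuous function `q` on
`[a,b]`, and the equation holds almost everywhere. -/
def IsSolution (a b : ℝ) (α β γ f u : ℝ → ℝ) : Prop :=
  MemH10 a b u ∧
    ∃ q : ℝ → ℝ, AbsolutelyContinuousOnInterval q a b ∧
      (∀ x ∈ Set.Ioo a b, DifferentiableAt ℝ u x → q x = α x * deriv u x) ∧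
      ∀ᵐ x ∂(volume.restrict (Set.Icc a b)), -deriv q x + β x * deriv u x + γ x * u x = f x

/-! ### Gauss and Lobatto points on `[-1,1]` -/

/-- The Legendre polynomial of degree `r` (Rodrigues' formula). -/
def legendre (r : ℕ) : Polynomial ℝ :=
  Polynomial.C (1 / (2 ^ r * (r.factorial : ℝ))) *
    Polynomial.derivative^[r] ((Polynomial.X ^ 2 - 1) ^ r)

/-- The `j`-th Gauss point, `1 ≤ j ≤ r`: the zeros of the Legendre polynomial in increasing
order. -/
def gaussRef (r j : ℕ) : ℝ :=
  ((legendre r).roots.sort (· ≤ ·)).getD (j - 1) 0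

/-- The `j`-th Lobatto point, `0 ≤ j ≤ r`: the end points `-1`, `1`, and between them the zeros
of the derivative of the Legendre polynomial in increasing order. -/
def lobattoRef (r j : ℕ) : ℝ :=
  if j = 0 then -1
  else if j = r then 1
  else ((Polynomial.derivative (legendre r)).roots.sort (· ≤ ·)).getD (j - 1) 0

/-! ### Meshes and spaces -/

/-- A partition `a = x_0 < x_1 < ⋯ < x_N = b`, with elements `τ_i = [x_{i-1}, x_i]`,
`1 ≤ i ≤ N`. -/
structure Mesh (a b : ℝ) where
  N : ℕ
  one_le_N : 1 ≤ N
  x : ℕ → ℝ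
  x_zero : x 0 = a
  x_N : x N = b
  x_lt : ∀ i < N, x i < x (i + 1)

namespace Mesh

variable {a b : ℝ} (P : Mesh a b)

/-- `h_i`, the length of `τ_i`. -/
def len (i : ℕ) : ℝ := P.x i - P.x (i - 1)

/-- The maximum over `1 ≤ i ≤ N`. -/
def maxOver (F : ℕ → ℝ) : ℝ :=
  (Finset.Icc 1 P.N).sup' (Finset.nonempty_Icc.mpr P.one_le_N) F

/-- The mesh size `h = max h_i`. -/
def h : ℝ := P.maxOver P.len

/-- The image in `τ_i` of the point `t ∈ [-1,1]`. -/
def affine (i : ℕ) (t : ℝ) : ℝ := (P.x i + P.x (i - 1) + P.len i * t) / 2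

/-- The Gauss points `g_{i,j}`, `1 ≤ j ≤ r`, with the convention `g_{i,r+1} = g_{i+1,1}`. -/
def gauss (r i j : ℕ) : ℝ :=
  if j = r + 1 then P.affine (i + 1) (gaussRef r 1) else P.affine i (gaussRef r j)

/-- The Lobatto points `l_{i,j}`, `0 ≤ j ≤ r`. -/
def lobatto (r i j : ℕ) : ℝ := P.affine i (lobattoRef r j)

/-- `v ∈ W^{m,p}_P`. -/
def MemBroken (m : ℕ) (p : ℝ≥0∞) (v : ℝ → ℝ) : Prop :=
  ContinuousOn v (Set.Icc a b) ∧ ∀ i ∈ Finset.Icc 1 P.N, MemW m p (P.x (i - 1)) (P.x i) v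

/-- The broken seminorm `|v|_{j,p,P}`. -/
def brokenSemi (j : ℕ) (p : ℝ≥0∞) (v : ℝ → ℝ) : ℝ :=
  if p = ∞ then P.maxOver (fun i => semi j p (P.x (i - 1)) (P.x i) v)
  else (∑ i ∈ Finset.Icc 1 P.N,
    semi j p (P.x (i - 1)) (P.x i) v ^ p.toReal) ^ (1 / p.toReal)

/-- `v ∈ U^r_P`: continuous, piecewise polynomial of degree `≤ r`, zero at `a` and `b`. -/
def IsTrial (r : ℕ) (v : ℝ → ℝ) : Prop :=
  ContinuousOn v (Set.Icc a b) ∧ v a = 0 ∧ v b = 0 ∧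
    ∀ i ∈ Finset.Icc 1 P.N, ∃ p : Polynomial ℝ, p.natDegree ≤ r ∧
      ∀ y ∈ Set.Icc (P.x (i - 1)) (P.x i), v y = p.eval y

/-- `uI` is the interpolant of `u` in `U^r_P` at the Lobatto points. -/
def IsInterpolant (r : ℕ) (u uI : ℝ → ℝ) : Prop :=
  P.IsTrial r uI ∧
    ∀ i ∈ Finset.Icc 1 P.N, ∀ j ≤ r, uI (P.lobatto r i j) = u (P.lobatto r i j)

/-! ### The test space

A test function `w = ∑ w_{i,j} ψ_{i,j}` over `1 ≤ i ≤ N`, `1 ≤ j ≤ r_i` is given by its family of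
coefficients; other entries of the family `w : ℕ → ℕ → ℝ` are never used. -/

/-- `r_i`, that is `r` for `i < N` and `r - 1` for `i = N`. -/
def rank (r i : ℕ) : ℕ := if i = P.N then r - 1 else r

/-- The coefficients `w_{i,j}`, `0 ≤ j ≤ r`, with the conventions `w_{1,0} = 0`, `w_{N,r} = 0`
and `w_{i,0} = w_{i-1,r}`. -/
def ext (r : ℕ) (w : ℕ → ℕ → ℝ) (i j : ℕ) : ℝ :=
  if j = 0 then (if i = 1 then 0 else w (i - 1) r)
  else if i = P.N ∧ j = r then 0
  else w i j

/-- The jump `[w_{i,j}] = w_{i,j} - w_{i,j-1}` at `g_{i,j}`. -/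
def jump (r : ℕ) (w : ℕ → ℕ → ℝ) (i j : ℕ) : ℝ := P.ext r w i j - P.ext r w i (j - 1)

/-- The piecewise constant function with coefficients `w`. -/
def testFun (r : ℕ) (w : ℕ → ℕ → ℝ) (y : ℝ) : ℝ :=
  ∑ i ∈ Finset.Icc 1 P.N, ∑ j ∈ Finset.Icc 1 (P.rank r i),
    w i j * Set.indicator (Set.Icc (P.gauss r i j) (P.gauss r i (j + 1))) 1 y

/-- `‖w‖_{P'}`, where `‖w‖_{P'}² = |w|²_{1,P'} + ‖w‖²_{0,P'}`. -/
def testNorm (r : ℕ) (w : ℕ → ℕ → ℝ) : ℝ :=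
  Real.sqrt
    ((∑ i ∈ Finset.Icc 1 P.N, ∑ j ∈ Finset.Icc 1 r, (P.len i)⁻¹ * P.jump r w i j ^ 2) +
      ∑ i ∈ Finset.Icc 1 P.N, ∑ j ∈ Finset.Icc 1 (P.rank r i), P.len i * w i j ^ 2)

/-! ### The finite volume scheme -/

/-- The finite volume bilinear form `a_P(v,w)`. -/
def bilin (r : ℕ) (α β γ v : ℝ → ℝ) (w : ℕ → ℕ → ℝ) : ℝ :=
  (∑ i ∈ Finset.Icc 1 P.N, ∑ j ∈ Finset.Icc 1 r,
      P.jump r w i j * (α (P.gauss r i j) * deriv v (P.gauss r i j))) +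
    ∑ i ∈ Finset.Icc 1 P.N, ∑ j ∈ Finset.Icc 1 (P.rank r i),
      w i j * ∫ y in (P.gauss r i j)..(P.gauss r i (j + 1)), (β y * deriv v y + γ y * v y)

/-- `uP` solves the finite volume scheme: `uP ∈ U^r_P` and `a_P(uP,w) = (f,w)` for all test
functions `w`. -/
def IsFVMSolution (r : ℕ) (α β γ f uP : ℝ → ℝ) : Prop :=
  P.IsTrial r uP ∧
    ∀ w : ℕ → ℕ → ℝ, P.bilin r α β γ uP w = ∫ y in a..b, f y * P.testFun r w y

end Mesh

end FVM

end

namespace FVM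

open Polynomial Set

/-! ### Rolle's theorem for finite sets of zeros -/

/-! Summation by parts turns the form into `a_P(v,w) = ∑ [w_{i,j}] (α v' - Φ_v)(g_{i,j})` with
`Φ_v(x) = ∫_a^x (β v' + γ v)` (`bilin_eq`). Everything is then a question about the flux and this
primitive at the Gauss points, and only the jump part of the test norm is needed.

Consistency. Put `e = u - u_I`. Legendre's equation says that the derivative of `(X² - 1) P_r'` is a
multiple of `P_r`. So a multiple of this polynomial, transported to the element, can be added to
`u_I` without changing its values at the Lobatto points or its derivative at the Gauss points.
Choosing the multiple to match `u^{(r+1)}` at the left end leaves a remainder whose derivative of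
order `r + 1` is controlled by `u^{(r+2)}`; Rolle's theorem and repeated mean value estimates then
show that `e'` gains one order at the Gauss points (`abs_deriv_sub_interpolant_gauss_le`). In `Φ_e`
the derivative is moved from `e` to `β`, so the sup norm of `e`, of order `h^{r+1}`, suffices. The
`L¹` norm of `β'` which this requires is bounded because `γ - β'/2 ≥ κ` bounds `β'` from above.

Stability. For a trial function `v`, take the test function whose jumps are `v'` at the Gauss points
times the quadrature weights. Exactness of Gauss quadrature makes these jumps compatible with the
conventions linking neighbouring elements. The flux part is at least `α₀ ∫ v'²`, since `v'²` is
integrated exactly. The rest is a quadrature for `-∫ v' Φ_v = ∫ v (β v' + γ v) ≥ κ ∫ v²`, with an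
error of order `√h` times the squared `H¹` norm, which is absorbed for small `h`
(`le_bilin_gaussTest`).

Conclusion. The flux of a solution is given at the Gauss points by the absolutely continuous `q`, so
`u` satisfies the scheme exactly (`bilin_eq_of_isSolution`). Hence `a_P(u_I - u_P, w) = a_P(u_I - u,
w)`, and stability meets consistency. -/

lemma exists_finset_zeros_deriv {f f' : ℝ → ℝ} {c d : ℝ} {n : ℕ} {s : Finset ℝ}
    (hf : ∀ x ∈ Icc c d, HasDerivWithinAt f (f' x) (Icc c d) x)
    (hs : ∀ x ∈ s, x ∈ Icc c d ∧ f x = 0) (hcard : s.card = n + 1) :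
    ∃ t : Finset ℝ, t.card = n ∧ ∀ x ∈ t, x ∈ Ioo c d ∧ f' x = 0 := by
  set z := s.orderEmbOfFin hcard with hz
  have hzmem : ∀ i, z i ∈ s := fun i => s.orderEmbOfFin_mem hcard i
  have key : ∀ i : Fin n, ∃ ξ ∈ Ioo (z i.castSucc) (z i.succ), f' ξ = 0 := by
    intro i
    have hsub : Icc (z i.castSucc) (z i.succ) ⊆ Icc c d :=
      Icc_subset_Icc (hs _ (hzmem _)).1.1 (hs _ (hzmem _)).1.2
    have hsub' : Ioo (z i.castSucc) (z i.succ) ⊆ Ioo c d :=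
      Ioo_subset_Ioo (hs _ (hzmem _)).1.1 (hs _ (hzmem _)).1.2
    refine exists_hasDerivAt_eq_zero (z.strictMono (Fin.castSucc_lt_succ)) (fun x hx =>
      ((hf x (hsub hx)).continuousWithinAt).mono hsub) ?_ (fun x hx => ?_)
    · rw [(hs _ (hzmem _)).2, (hs _ (hzmem _)).2]
    · exact (hf x (hsub (Ioo_subset_Icc_self hx))).hasDerivAt
        (Icc_mem_nhds (hsub' hx).1 (hsub' hx).2)
  choose ξ hξ hξ0 using key
  -- The Rolle points lie in successive disjoint gaps, hence are distinct.
  have hmono : StrictMono ξ := by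
    intro i j hij
    have h1 : z i.succ ≤ z j.castSucc := z.monotone (Fin.succ_le_castSucc_iff.mpr hij)
    exact (hξ i).2.trans_le (h1.trans (hξ j).1.le)
  refine ⟨Finset.univ.map ⟨ξ, hmono.injective⟩, by simp, ?_⟩
  intro x hx
  obtain ⟨i, -, rfl⟩ := Finset.mem_map.mp hx
  exact ⟨⟨(hs _ (hzmem _)).1.1.trans_lt (hξ i).1, (hξ i).2.trans_le (hs _ (hzmem _)).1.2⟩, hξ0 i⟩

lemma exists_finset_roots_derivative {p : ℝ[X]} {c d : ℝ} {n : ℕ} {s : Finset ℝ}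
    (hs : ∀ x ∈ s, x ∈ Icc c d ∧ p.eval x = 0) (hcard : s.card = n + 1) :
    ∃ t : Finset ℝ, t.card = n ∧ ∀ x ∈ t, x ∈ Ioo c d ∧ p.derivative.eval x = 0 :=
  exists_finset_zeros_deriv (f := fun x => p.eval x) (f' := fun x => p.derivative.eval x)
    (fun x _ => (p.hasDerivAt x).hasDerivWithinAt) hs hcard

/-! ### Sorted roots -/

/-- By the degree bound, `n` distinct known zeros exhaust the multiset of roots. So all roots are
simple, the sorted list has length exactly `n`, and the default value of `getD` is never read for
indices below `n`. -/
lemma sort_roots_of_card {p : ℝ[X]} {n : ℕ} (hp : p ≠ 0) (hn : p.natDegree ≤ n) {t : Finset ℝ}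
    (ht : t.card = n) (hroot : ∀ x ∈ t, x ∈ Ioo (-1 : ℝ) 1 ∧ p.eval x = 0) :
    (∀ j < n, (p.roots.sort (· ≤ ·)).getD j 0 ∈ Ioo (-1 : ℝ) 1 ∧
      p.eval ((p.roots.sort (· ≤ ·)).getD j 0) = 0) ∧
    ∀ j k, j < k → k < n →
      (p.roots.sort (· ≤ ·)).getD j 0 < (p.roots.sort (· ≤ ·)).getD k 0 := by
  have hle : t.val ≤ p.roots := by
    rw [Multiset.le_iff_subset t.nodup]
    intro x hx
    exact (mem_roots hp).mpr (hroot x hx).2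
  have heq : t.val = p.roots :=
    Multiset.eq_of_le_of_card_le hle ((card_roots' p).trans (hn.trans ht.ge))
  rw [← heq]
  set L := t.val.sort (· ≤ ·) with hL
  have hlen : L.length = n := by rw [hL, Multiset.length_sort]; exact ht
  have hnd : L.Nodup := by
    rw [← Multiset.coe_nodup, hL, Multiset.sort_eq]; exact t.nodup
  have hpw : L.Pairwise (· ≤ ·) := Multiset.pairwise_sort _ _
  refine ⟨fun j hj => ?_, fun j k hjk hk => ?_⟩
  · have hj' : j < L.length := hlen ▸ hj
    rw [List.getD_eq_getElem _ _ hj']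
    exact hroot _ ((Multiset.mem_sort (· ≤ ·)).mp (List.getElem_mem hj'))
  · have hk' : k < L.length := hlen ▸ hk
    have hj' : j < L.length := hjk.trans hk'
    rw [List.getD_eq_getElem _ _ hj', List.getD_eq_getElem _ _ hk']
    refine lt_of_le_of_ne (List.pairwise_iff_getElem.mp hpw j k hj' hk' hjk) ?_
    intro h
    exact hjk.ne ((hnd.getElem_inj_iff).mp h)

/-! ### Legendre polynomials -/

/-- The polynomial `(X² - 1)^r`. -/
noncomputable def rodrigues (r : ℕ) : ℝ[X] := (X ^ 2 - 1) ^ r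

lemma legendre_eq (r : ℕ) :
    legendre r = C (1 / (2 ^ r * (r.factorial : ℝ))) * derivative^[r] (rodrigues r) := rfl

lemma natDegree_rodrigues (r : ℕ) : (rodrigues r).natDegree = 2 * r := by
  have : (X ^ 2 - 1 : ℝ[X]) = X ^ 2 - C 1 := by simp
  rw [rodrigues, natDegree_pow, this, natDegree_X_pow_sub_C, mul_comm]

lemma natDegree_iterate_derivative_rodrigues (r k : ℕ) :
    (derivative^[k] (rodrigues r)).natDegree = 2 * r - k := by
  induction k with
  | zero => simp [natDegree_rodrigues]
  | succ k ih => rw [Function.iterate_succ_apply', natDegree_derivative, ih]; omega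

lemma legendre_const_ne_zero (r : ℕ) : (1 / (2 ^ r * (r.factorial : ℝ))) ≠ 0 := by positivity

lemma natDegree_legendre (r : ℕ) : (legendre r).natDegree = r := by
  rw [legendre_eq, natDegree_C_mul (legendre_const_ne_zero r),
    natDegree_iterate_derivative_rodrigues]
  omega

lemma eval_iterate_derivative_rodrigues {r k : ℕ} (hk : k < r) {x : ℝ} (hx : x ^ 2 = 1) :
    (derivative^[k] (rodrigues r)).eval x = 0 := by
  obtain ⟨q, hq⟩ := pow_sub_dvd_iterate_derivative_pow (X ^ 2 - 1 : ℝ[X]) r k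
  rw [rodrigues, hq, eval_mul, eval_pow]
  simp [hx, Nat.sub_ne_zero_of_lt hk]

/-- As long as `k < r`, the `k`-th derivative still vanishes at `±1`. With its `k` interior zeros
this makes `k + 2` zeros, and Rolle gives `k + 1` interior ones for the next derivative. -/
lemma exists_roots_iterate_derivative_rodrigues (r k : ℕ) (hk : k ≤ r) :
    ∃ t : Finset ℝ, t.card = k ∧
      ∀ x ∈ t, x ∈ Ioo (-1 : ℝ) 1 ∧ (derivative^[k] (rodrigues r)).eval x = 0 := by
  induction k with
  | zero => exact ⟨∅, by simp⟩
  | succ k ih =>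
    obtain ⟨t, ht, hroot⟩ := ih (by omega)
    have h1 : (1 : ℝ) ∉ t := fun h => absurd (hroot 1 h).1.2 (lt_irrefl _)
    have h2 : (-1 : ℝ) ∉ insert 1 t := by
      intro h
      rcases Finset.mem_insert.mp h with h | h
      · norm_num at h
      · exact absurd (hroot _ h).1.1 (lt_irrefl _)
    rw [Function.iterate_succ_apply']
    refine exists_finset_roots_derivative (s := insert (-1) (insert 1 t)) (fun x hx => ?_) ?_
    · rcases Finset.mem_insert.mp hx with rfl | hx
      · exact ⟨by norm_num, eval_iterate_derivative_rodrigues (by omega) (by norm_num)⟩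
      rcases Finset.mem_insert.mp hx with rfl | hx
      · exact ⟨by norm_num, eval_iterate_derivative_rodrigues (by omega) (by norm_num)⟩
      · exact ⟨Ioo_subset_Icc_self (hroot x hx).1, (hroot x hx).2⟩
    · rw [Finset.card_insert_of_notMem h2, Finset.card_insert_of_notMem h1, ht]

lemma exists_roots_legendre (r : ℕ) :
    ∃ t : Finset ℝ, t.card = r ∧ ∀ x ∈ t, x ∈ Ioo (-1 : ℝ) 1 ∧ (legendre r).eval x = 0 := by
  obtain ⟨t, ht, h⟩ := exists_roots_iterate_derivative_rodrigues r r le_rfl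
  refine ⟨t, ht, fun x hx => ⟨(h x hx).1, ?_⟩⟩
  rw [legendre_eq, eval_mul, (h x hx).2, mul_zero]

lemma legendre_ne_zero (r : ℕ) : legendre r ≠ 0 := by
  intro h
  rcases Nat.eq_zero_or_pos r with rfl | hr
  · simp [legendre] at h
  · have := natDegree_legendre r
    rw [h, natDegree_zero] at this
    omega

lemma gaussRef_spec (r : ℕ) :
    (∀ j ∈ Finset.Icc 1 r, gaussRef r j ∈ Ioo (-1 : ℝ) 1 ∧ (legendre r).eval (gaussRef r j) = 0) ∧
    ∀ j k, 1 ≤ j → j < k → k ≤ r → gaussRef r j < gaussRef r k := by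
  obtain ⟨t, ht, h⟩ := exists_roots_legendre r
  obtain ⟨h1, h2⟩ := sort_roots_of_card (legendre_ne_zero r) (natDegree_legendre r).le ht h
  refine ⟨fun j hj => ?_, fun j k hj hjk hk => ?_⟩
  · rw [Finset.mem_Icc] at hj
    exact h1 (j - 1) (by omega)
  · exact h2 (j - 1) (k - 1) (by omega) (by omega)

lemma gaussRef_mem {r j : ℕ} (hj : j ∈ Finset.Icc 1 r) : gaussRef r j ∈ Ioo (-1 : ℝ) 1 :=
  ((gaussRef_spec r).1 j hj).1

lemma gaussRef_injOn (r : ℕ) : Set.InjOn (gaussRef r) (Finset.Icc 1 r : Finset ℕ) := by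
  intro j hj k hk h
  simp only [Finset.coe_Icc, mem_Icc] at hj hk
  rcases lt_trichotomy j k with hjk | hjk | hjk
  · exact absurd h ((gaussRef_spec r).2 j k hj.1 hjk hk.2).ne
  · exact hjk
  · exact absurd h ((gaussRef_spec r).2 k j hk.1 hjk hj.2).ne'

lemma lobattoRef_spec {r : ℕ} (hr : 1 ≤ r) :
    (∀ j, 1 ≤ j → j < r → lobattoRef r j ∈ Ioo (-1 : ℝ) 1 ∧
      (derivative (legendre r)).eval (lobattoRef r j) = 0) ∧
    ∀ j k, 1 ≤ j → j < k → k < r → lobattoRef r j < lobattoRef r k := by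
  obtain ⟨t, ht, h⟩ := exists_roots_legendre r
  obtain ⟨s, hs, h'⟩ := exists_finset_roots_derivative (n := r - 1)
    (fun x hx => ⟨Ioo_subset_Icc_self (h x hx).1, (h x hx).2⟩) (by omega)
  have hne : derivative (legendre r) ≠ 0 := by
    rw [derivative_ne_zero, natDegree_legendre]
    omega
  obtain ⟨h1, h2⟩ := sort_roots_of_card hne
    (by rw [natDegree_derivative, natDegree_legendre]) hs h'
  refine ⟨fun j hj hjr => ?_, fun j k hj hjk hk => ?_⟩
  · rw [lobattoRef, if_neg (by omega), if_neg (by omega)]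
    exact h1 (j - 1) (by omega)
  · rw [lobattoRef, if_neg (by omega), if_neg (by omega), lobattoRef, if_neg (by omega),
      if_neg (by omega)]
    exact h2 (j - 1) (k - 1) (by omega) (by omega)

lemma lobattoRef_zero (r : ℕ) : lobattoRef r 0 = -1 := by simp [lobattoRef]

lemma lobattoRef_last {r : ℕ} (hr : 1 ≤ r) : lobattoRef r r = 1 := by
  rw [lobattoRef, if_neg (by omega), if_pos rfl]

lemma lobattoRef_mem {r j : ℕ} (hr : 1 ≤ r) (hj : j ≤ r) : lobattoRef r j ∈ Icc (-1 : ℝ) 1 := by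
  rcases Nat.eq_zero_or_pos j with rfl | hj0
  · rw [lobattoRef_zero]; norm_num
  rcases hj.eq_or_lt with rfl | hj
  · rw [lobattoRef_last hr]; norm_num
  · exact Ioo_subset_Icc_self ((lobattoRef_spec hr).1 j hj0 hj).1

lemma lobattoRef_lt {r : ℕ} (hr : 1 ≤ r) {j k : ℕ} (hjk : j < k) (hk : k ≤ r) :
    lobattoRef r j < lobattoRef r k := by
  obtain ⟨h1, h2⟩ := lobattoRef_spec hr
  rcases Nat.eq_zero_or_pos j with rfl | hj0
  · rw [lobattoRef_zero]
    rcases hk.eq_or_lt with rfl | hk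
    · rw [lobattoRef_last hr]; norm_num
    · exact (h1 k (by omega) hk).1.1
  · rcases hk.eq_or_lt with rfl | hk
    · rw [lobattoRef_last hr]; exact (h1 j hj0 hjk).1.2
    · exact h2 j k hj0 hjk hk

/-- The polynomial `(X² - 1) P_r'`, which vanishes at the Lobatto points. -/
noncomputable def lobattoPoly (r : ℕ) : ℝ[X] := (X ^ 2 - 1) * derivative (legendre r)

lemma eval_lobattoPoly {r j : ℕ} (hr : 1 ≤ r) (hj : j ≤ r) :
    (lobattoPoly r).eval (lobattoRef r j) = 0 := by
  rw [lobattoPoly, eval_mul]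
  rcases Nat.eq_zero_or_pos j with rfl | hj0
  · rw [lobattoRef_zero]; simp
  rcases hj.eq_or_lt with rfl | hj
  · rw [lobattoRef_last hr]; simp
  · rw [((lobattoRef_spec hr).1 j hj0 hj).2, mul_zero]

/-- The relation `(X² - 1) R' = 2 r X R` for `R = (X² - 1)^r`, differentiated `k + 1` times. The
case `k = r` is Legendre's equation. -/
lemma rodrigues_ode (r k : ℕ) : ∃ b : ℝ, b = (k - 2 * r) * (k + 1) ∧
    (X ^ 2 - 1) * derivative^[k + 2] (rodrigues r) +
      C (2 - 2 * r + 2 * k : ℝ) * (X * derivative^[k + 1] (rodrigues r)) +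
      C b * derivative^[k] (rodrigues r) = 0 := by
  refine ⟨_, rfl, ?_⟩
  induction k with
  | zero =>
    have h : (X ^ 2 - 1) * derivative (rodrigues r) = C (2 * r : ℝ) * (X * rodrigues r) := by
      rcases r with _ | r
      · simp [rodrigues]
      · rw [rodrigues, derivative_pow]
        simp only [derivative_sub, derivative_X_pow, derivative_one, map_mul, map_natCast,
          map_ofNat, Nat.add_sub_cancel]
        push_cast
        ring
    have h' := congrArg derivative h
    simp only [derivative_mul, derivative_sub, derivative_X_pow, derivative_one, derivative_C,
      derivative_X] at h'
    simp only [Function.iterate_succ_apply', Function.iterate_zero, id]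
    simp only [map_mul, map_natCast, map_add, map_sub, map_one, map_ofNat, map_zero,
      Nat.cast_zero] at h' ⊢
    linear_combination h'
  | succ k ih =>
    have h' := congrArg derivative ih
    simp only [derivative_mul, derivative_sub, derivative_X_pow, derivative_one, derivative_C,
      derivative_X, derivative_add, derivative_zero, ← Function.iterate_succ_apply'] at h'
    simp only [map_mul, map_natCast, map_add, map_sub, map_one, map_ofNat,
      Nat.cast_add, Nat.cast_one] at h' ⊢
    linear_combination h'

/-- Legendre's equation in divergence form. It links the two families of points: the polynomial
vanishing at the Lobatto points has its critical points at the Gauss points. This is the source of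
the superconvergence. -/
lemma derivative_lobattoPoly (r : ℕ) :
    derivative (lobattoPoly r) = C (r * (r + 1) : ℝ) * legendre r := by
  obtain ⟨b, hb, h⟩ := rodrigues_ode r r
  have h2 : derivative (lobattoPoly r) = C (1 / (2 ^ r * (r.factorial : ℝ))) *
      ((X ^ 2 - 1) * derivative^[r + 2] (rodrigues r) +
        2 * (X * derivative^[r + 1] (rodrigues r))) := by
    rw [lobattoPoly, legendre_eq]
    simp only [derivative_mul, derivative_sub, derivative_X_pow, derivative_one, derivative_C,
      zero_mul, zero_add, Function.iterate_succ_apply']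
    simp only [Nat.cast_ofNat, map_ofNat]
    ring
  rw [h2, legendre_eq]
  subst hb
  simp only [map_mul, map_natCast, map_add, map_sub, map_one, map_ofNat] at h ⊢
  linear_combination C (1 / (2 ^ r * (r.factorial : ℝ))) * h

lemma natDegree_lobattoPoly {r : ℕ} (hr : 1 ≤ r) : (lobattoPoly r).natDegree = r + 1 := by
  have h1 := natDegree_derivative (lobattoPoly r)
  rw [derivative_lobattoPoly, natDegree_C_mul (by positivity), natDegree_legendre] at h1
  omega

/-! ### Orthogonality and Gauss quadrature -/

/-- Each integration by parts lowers both `k` and the degree of `q`; boundary terms vanish because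
derivatives of order below `r` are zero at `±1`. -/
lemma integral_iterate_derivative_rodrigues_mul (r k : ℕ) (hk : k ≤ r) (q : ℝ[X])
    (hq : q.natDegree < k) :
    ∫ x in (-1 : ℝ)..1, (derivative^[k] (rodrigues r)).eval x * q.eval x = 0 := by
  induction k generalizing q with
  | zero => omega
  | succ k ih =>
    have hpart := intervalIntegral.integral_mul_deriv_eq_deriv_mul (a := (-1 : ℝ)) (b := 1)
      (u := fun x => q.eval x) (v := fun x => (derivative^[k] (rodrigues r)).eval x)
      (u' := fun x => (derivative q).eval x)
      (v' := fun x => (derivative^[k + 1] (rodrigues r)).eval x)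
      (fun x _ => q.hasDerivAt x)
      (fun x _ => by
        rw [Function.iterate_succ_apply']; exact (derivative^[k] (rodrigues r)).hasDerivAt x)
      ((derivative q).continuous.intervalIntegrable _ _)
      ((derivative^[k + 1] (rodrigues r)).continuous.intervalIntegrable _ _)
    simp only [mul_comm (q.eval _)] at hpart
    rw [hpart, eval_iterate_derivative_rodrigues (by omega) (by norm_num),
      eval_iterate_derivative_rodrigues (by omega) (by norm_num)]
    have h0 : ∫ x in (-1 : ℝ)..1, (derivative q).eval x *
        (derivative^[k] (rodrigues r)).eval x = 0 := by
      rcases Nat.eq_zero_or_pos k with rfl | hk0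
      · have : derivative q = 0 := by
          rw [derivative_eq_zero]; omega
        simp [this]
      · simp only [mul_comm ((derivative q).eval _)]
        exact ih (by omega) _ (by rw [natDegree_derivative]; omega)
    simp [h0]

lemma integral_legendre_mul (r : ℕ) (q : ℝ[X]) (hq : q.natDegree < r) :
    ∫ x in (-1 : ℝ)..1, (legendre r).eval x * q.eval x = 0 := by
  have := integral_iterate_derivative_rodrigues_mul r r le_rfl q hq
  simp only [legendre_eq, eval_mul, eval_C, mul_assoc]
  rw [intervalIntegral.integral_const_mul, this, mul_zero]

/-- The weight of the `j`-th Gauss point. -/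
noncomputable def gaussWeight (r j : ℕ) : ℝ :=
  ∫ x in (-1 : ℝ)..1, (Lagrange.basis (Finset.Icc 1 r) (gaussRef r) j).eval x

lemma sum_gaussWeight_of_degree_lt (r : ℕ) (p : ℝ[X]) (hp : p.degree < r) :
    ∑ j ∈ Finset.Icc 1 r, gaussWeight r j * p.eval (gaussRef r j) =
      ∫ x in (-1 : ℝ)..1, p.eval x := by
  conv_rhs => rw [Lagrange.eq_interpolate (gaussRef_injOn r) (f := p) (by simpa using hp)]
  simp only [Lagrange.interpolate_apply, eval_finsetSum, eval_mul, eval_C]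
  rw [intervalIntegral.integral_finsetSum]
  · refine Finset.sum_congr rfl fun j _ => ?_
    rw [intervalIntegral.integral_const_mul, mul_comm, gaussWeight]
  · intro j _
    exact (continuous_const.mul (Polynomial.continuous _)).intervalIntegrable _ _

/-- Divide by the Legendre polynomial: the quotient has degree below `r`, so the multiple of `P_r`
has zero integral by orthogonality and is zero at the nodes. The remainder is handled by
interpolation. -/
lemma sum_gaussWeight (r : ℕ) (hr : 1 ≤ r) (p : ℝ[X]) (hp : p.natDegree ≤ 2 * r - 1) :
    ∑ j ∈ Finset.Icc 1 r, gaussWeight r j * p.eval (gaussRef r j) =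
      ∫ x in (-1 : ℝ)..1, p.eval x := by
  set P := legendre r
  have hdiv : p % P + P * (p / P) = p := EuclideanDomain.mod_add_div p P
  have hdeg : (p % P).degree < r := by
    have := degree_mod_lt p (legendre_ne_zero r)
    rwa [show (legendre r).degree = r from
      (degree_eq_natDegree (legendre_ne_zero r)).trans (by rw [natDegree_legendre])] at this
  have hq : (p / P).natDegree < r := by
    by_cases h0 : p / P = 0
    · rw [h0, natDegree_zero]; omega
    · have h1 : (P * (p / P)).natDegree = r + (p / P).natDegree := by
        rw [natDegree_mul (legendre_ne_zero r) h0, natDegree_legendre]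
      have h2 : P * (p / P) = p - p % P := eq_sub_of_add_eq' hdiv
      have h3 := natDegree_sub_le p (p % P)
      have h4 : (p % P).natDegree ≤ r := natDegree_le_of_degree_le hdeg.le
      rw [← h2, h1] at h3
      rcases le_max_iff.mp h3 with h | h <;> omega
  have hint : ∫ x in (-1 : ℝ)..1, p.eval x = ∫ x in (-1 : ℝ)..1, (p % P).eval x := by
    conv_lhs => rw [← hdiv]
    simp only [eval_add, eval_mul]
    rw [intervalIntegral.integral_add (Continuous.intervalIntegrable (by fun_prop) _ _)
      (Continuous.intervalIntegrable (by fun_prop) _ _), integral_legendre_mul r _ hq, add_zero]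
  rw [hint, ← sum_gaussWeight_of_degree_lt r _ hdeg]
  refine Finset.sum_congr rfl fun j hj => ?_
  conv_lhs => rw [← hdiv]
  rw [eval_add, eval_mul, ((gaussRef_spec r).1 j hj).2, zero_mul, add_zero]

/-- The square of a Lagrange basis polynomial has degree `2 r - 2`, so the rule is exact for it: the
weight is the integral of that square. -/
lemma gaussWeight_nonneg {r j : ℕ} (hj : j ∈ Finset.Icc 1 r) : 0 ≤ gaussWeight r j := by
  have hr : 1 ≤ r := by rw [Finset.mem_Icc] at hj; omega
  set l := Lagrange.basis (Finset.Icc 1 r) (gaussRef r) j with hl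
  have hdeg : l.natDegree = r - 1 := by
    rw [hl, Lagrange.natDegree_basis (gaussRef_injOn r) hj]; simp
  have h := sum_gaussWeight r hr (l ^ 2) ((natDegree_pow_le).trans (by omega))
  rw [Finset.sum_eq_single_of_mem j hj] at h
  · rw [eval_pow, Lagrange.eval_basis_self (gaussRef_injOn r) hj, one_pow, mul_one] at h
    rw [h]
    refine intervalIntegral.integral_nonneg (by norm_num) fun x _ => ?_
    rw [eval_pow]; positivity
  · intro k hk hkj
    rw [eval_pow, Lagrange.eval_basis_of_ne (Ne.symm hkj) hk]
    simp

lemma sum_gaussWeight_eq_two {r : ℕ} (hr : 1 ≤ r) : ∑ j ∈ Finset.Icc 1 r, gaussWeight r j = 2 := by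
  have := sum_gaussWeight r hr 1 (by simp)
  simp at this
  rw [this]; norm_num

lemma gaussWeight_le_two {r j : ℕ} (hj : j ∈ Finset.Icc 1 r) : gaussWeight r j ≤ 2 := by
  rw [← sum_gaussWeight_eq_two (r := r) (by rw [Finset.mem_Icc] at hj; omega)]
  exact Finset.single_le_sum (fun k hk => gaussWeight_nonneg hk) hj

end FVM

namespace FVM

open Polynomial Set

/-! ### Integral inequalities -/

/-- Cauchy–Schwarz, read off from the nonnegative variance of `|g|` about its mean `m / l`. -/
lemma sq_integral_abs_le {g : ℝ → ℝ} {c d : ℝ} (hcd : c ≤ d)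
    (hg : IntervalIntegrable g volume c d)
    (hg2 : IntervalIntegrable (fun x => g x ^ 2) volume c d) :
    (∫ x in c..d, |g x|) ^ 2 ≤ (d - c) * ∫ x in c..d, g x ^ 2 := by
  rcases hcd.eq_or_lt with rfl | hlt
  · simp
  set m := ∫ x in c..d, |g x|
  set l := d - c with hl
  have hl0 : 0 < l := sub_pos.mpr hlt
  have h0 : 0 ≤ ∫ x in c..d, (|g x| - m / l) ^ 2 :=
    intervalIntegral.integral_nonneg hcd fun x _ => sq_nonneg _
  have h1 : ∫ x in c..d, (|g x| - m / l) ^ 2 =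
      (∫ x in c..d, g x ^ 2) - 2 * (m / l) * m + (m / l) ^ 2 * l := by
    have he : ∀ x, (|g x| - m / l) ^ 2 = g x ^ 2 - 2 * (m / l) * |g x| + (m / l) ^ 2 := by
      intro x; rw [← sq_abs (g x)]; ring
    simp only [he]
    rw [intervalIntegral.integral_add (hg2.sub (hg.abs.const_mul _)) (by simp),
      intervalIntegral.integral_sub hg2 (hg.abs.const_mul _),
      intervalIntegral.integral_const_mul, intervalIntegral.integral_const]
    simp only [smul_eq_mul, ← hl]
    ring
  rw [h1] at h0
  have h2 : 2 * (m / l) * m - (m / l) ^ 2 * l = m ^ 2 / l := by field_simp; ring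
  have h3 : m ^ 2 / l ≤ ∫ x in c..d, g x ^ 2 := by linarith
  rw [div_le_iff₀ hl0] at h3
  linarith

lemma integral_abs_le_sqrt {g : ℝ → ℝ} {c d : ℝ} (hcd : c ≤ d)
    (hg : IntervalIntegrable g volume c d)
    (hg2 : IntervalIntegrable (fun x => g x ^ 2) volume c d) :
    ∫ x in c..d, |g x| ≤ Real.sqrt (d - c) * Real.sqrt (∫ x in c..d, g x ^ 2) := by
  rw [← Real.sqrt_mul (sub_nonneg.mpr hcd)]
  exact Real.le_sqrt_of_sq_le (sq_integral_abs_le hcd hg hg2)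

lemma toReal_eLpNorm_two_sq {g : ℝ → ℝ} {c d : ℝ} (hcd : c ≤ d)
    (hg : MemLp g 2 (volume.restrict (Icc c d))) :
    (eLpNorm g 2 (volume.restrict (Icc c d))).toReal ^ 2 = ∫ x in c..d, g x ^ 2 := by
  rw [intervalIntegral.integral_of_le hcd, ← integral_Icc_eq_integral_Ioc,
    hg.eLpNorm_eq_integral_rpow_norm (by norm_num) (by norm_num),
    ENNReal.toReal_ofReal (by positivity)]
  have h : ∀ x, ‖g x‖ ^ (2 : ℝ≥0∞).toReal = g x ^ 2 := fun x => by
    rw [ENNReal.toReal_ofNat, Real.rpow_ofNat, Real.norm_eq_abs, sq_abs]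
  simp only [h]
  rw [ENNReal.toReal_ofNat, ← Real.rpow_natCast, ← Real.rpow_mul (integral_nonneg fun x => sq_nonneg _)]
  norm_num

lemma MemLp.intervalIntegrable_of_two {g : ℝ → ℝ} {c d : ℝ} (hcd : c ≤ d)
    (hg : MemLp g 2 (volume.restrict (Icc c d))) :
    IntervalIntegrable g volume c d ∧ IntervalIntegrable (fun x => g x ^ 2) volume c d := by
  rw [intervalIntegrable_iff_integrableOn_Icc_of_le hcd,
    intervalIntegrable_iff_integrableOn_Icc_of_le hcd]
  exact ⟨hg.integrable (by norm_num), hg.integrable_sq⟩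

/-! ### Absolutely continuous functions with continuous derivative -/

lemma ae_derivWithin_eq_deriv (f : ℝ → ℝ) (c d : ℝ) :
    ∀ᵐ x ∂volume, x ∈ Icc c d → derivWithin f (Icc c d) x = deriv f x := by
  have h1 : ∀ᵐ x ∂(volume : Measure ℝ), x ≠ c := by simp [ae_iff]
  have h2 : ∀ᵐ x ∂(volume : Measure ℝ), x ≠ d := by simp [ae_iff]
  filter_upwards [h1, h2] with x hc hd hx
  exact derivWithin_of_mem_nhds (Icc_mem_nhds (lt_of_le_of_ne hx.1 hc.symm)
    (lt_of_le_of_ne hx.2 hd))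

lemma integral_derivWithin_eq_sub {f : ℝ → ℝ} {c d : ℝ}
    (hf : AbsolutelyContinuousOnInterval f c d) {x y : ℝ} (hx : x ∈ Icc c d) (hy : y ∈ Icc c d) :
    ∫ t in x..y, derivWithin f (Icc c d) t = f y - f x := by
  have hsub : uIcc x y ⊆ Icc c d := uIcc_subset_Icc hx hy
  rw [← (hf.mono (hsub.trans Icc_subset_uIcc)).integral_deriv_eq_sub]
  refine intervalIntegral.integral_congr_ae ?_
  filter_upwards [ae_derivWithin_eq_deriv f c d] with t ht htu
  exact ht (hsub (uIoc_subset_uIcc htu))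

/-- Absolute continuity makes `f` the integral of its derivative, and the integral of a continuous
function is differentiable everywhere. Rolle and mean value arguments need this upgrade from almost
every point to every point. -/
lemma hasDerivWithinAt_of_continuousOn_derivWithin {f : ℝ → ℝ} {c d : ℝ} (hcd : c ≤ d)
    (hf : AbsolutelyContinuousOnInterval f c d)
    (hf' : ContinuousOn (derivWithin f (Icc c d)) (Icc c d)) {x : ℝ} (hx : x ∈ Icc c d) :
    HasDerivWithinAt f (derivWithin f (Icc c d) x) (Icc c d) x := by
  -- Constant extension past the end points gives a continuous integrand on the whole line, so `c`
  -- and `d` need no separate treatment.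
  set G : ℝ → ℝ := IccExtend hcd ((Icc c d).domRestrict (derivWithin f (Icc c d))) with hG
  have hGc : Continuous G := (continuousOn_iff_continuous_domRestrict.mp hf').Icc_extend'
  have hGe : ∀ y ∈ Icc c d, G y = derivWithin f (Icc c d) y := fun y hy => by
    rw [hG, IccExtend_of_mem _ _ hy]; rfl
  have h1 : HasDerivAt (fun y => f c + ∫ t in c..y, G t) (G x) x :=
    (hGc.integral_hasStrictDerivAt c x).hasDerivAt.const_add _
  rw [← hGe x hx]
  have heq : ∀ y ∈ Icc c d, f y = f c + ∫ t in c..y, G t := by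
    intro y hy
    have hc : c ∈ Icc c d := left_mem_Icc.mpr hcd
    have : ∫ t in c..y, G t = ∫ t in c..y, derivWithin f (Icc c d) t :=
      intervalIntegral.integral_congr fun t ht => hGe t (uIcc_subset_Icc hc hy ht)
    rw [this, integral_derivWithin_eq_sub hf hc hy]
    ring
  exact h1.hasDerivWithinAt.congr heq (heq x hx)

lemma MemW.hasDerivWithinAt {m : ℕ} {p : ℝ≥0∞} {c d : ℝ} {u : ℝ → ℝ} (hcd : c ≤ d)
    (hu : MemW m p c d u) {j : ℕ} (hj : j + 1 < m) {x : ℝ} (hx : x ∈ Icc c d) :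
    HasDerivWithinAt (iteratedDerivWithin j u (Icc c d))
      (iteratedDerivWithin (j + 1) u (Icc c d) x) (Icc c d) x := by
  have h1 := hu.1 (j + 1) hj
  rw [iteratedDerivWithin_succ] at h1
  rw [iteratedDerivWithin_succ]
  refine hasDerivWithinAt_of_continuousOn_derivWithin hcd (hu.1 j (by omega)) ?_ hx
  have h2 := h1.continuousOn
  rwa [uIcc_of_le hcd] at h2

lemma MemW.abs_sub_le {m : ℕ} {c d : ℝ} {u : ℝ → ℝ} (hcd : c ≤ d) (hu : MemW (m + 1) 2 c d u)
    {x : ℝ} (hx : x ∈ Icc c d) :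
    |iteratedDerivWithin m u (Icc c d) x - iteratedDerivWithin m u (Icc c d) c| ≤
      Real.sqrt (d - c) * semi (m + 1) 2 c d u := by
  have hL := hu.2 (m + 1) le_rfl
  have hI := MemLp.intervalIntegrable_of_two hcd hL
  have hs : semi (m + 1) 2 c d u =
      Real.sqrt (∫ t in c..d, iteratedDerivWithin (m + 1) u (Icc c d) t ^ 2) := by
    rw [← toReal_eLpNorm_two_sq hcd hL, Real.sqrt_sq ENNReal.toReal_nonneg]; rfl
  rw [hs, ← integral_derivWithin_eq_sub (hu.1 m (by omega)) (left_mem_Icc.mpr hcd) hx]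
  simp only [iteratedDerivWithin_succ] at hI ⊢
  refine le_trans ?_ (integral_abs_le_sqrt hcd hI.1 hI.2)
  refine (intervalIntegral.abs_integral_le_integral_abs hx.1).trans ?_
  exact intervalIntegral.integral_mono_interval le_rfl hx.1 hx.2
    (Filter.Eventually.of_forall fun t => abs_nonneg _) hI.1.abs

lemma le_of_ae_le_of_continuousOn {g : ℝ → ℝ} {c d M : ℝ} (hcd : c < d)
    (hg : ContinuousOn g (Icc c d)) (hae : ∀ᵐ y ∂(volume.restrict (Icc c d)), g y ≤ M) {x : ℝ}
    (hx : x ∈ Icc c d) : g x ≤ M := by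
  have heq := Measure.eqOn_Icc_of_ae_eq volume hcd.ne
    (f := fun y => max (g y) M) (g := fun _ => M)
    (by filter_upwards [hae] with y hy; exact max_eq_right hy)
    (hg.sup continuousOn_const) continuousOn_const hx
  exact max_eq_right_iff.mp heq

lemma MemW.abs_le_semi_top {m : ℕ} {c d : ℝ} {u : ℝ → ℝ} (hcd : c < d) (hu : MemW (m + 1) 2 c d u)
    {x : ℝ} (hx : x ∈ Icc c d) :
    |iteratedDerivWithin m u (Icc c d) x| ≤ semi m ∞ c d u := by
  set g := iteratedDerivWithin m u (Icc c d) with hg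
  have hgc : ContinuousOn g (Icc c d) := by
    have := (hu.1 m (by omega)).continuousOn
    rwa [uIcc_of_le hcd.le] at this
  obtain ⟨B, hB⟩ := isCompact_Icc.exists_bound_of_continuousOn hgc
  have hfin : eLpNorm g ∞ (volume.restrict (Icc c d)) ≠ ∞ := by
    rw [eLpNorm_exponent_top]
    refine (eLpNormEssSup_lt_top_of_ae_bound (C := B) ?_).ne
    exact (ae_restrict_iff' measurableSet_Icc).mpr (Filter.Eventually.of_forall hB)
  have hae : ∀ᵐ y ∂(volume.restrict (Icc c d)), |g y| ≤ semi m ∞ c d u := by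
    filter_upwards [enorm_ae_le_eLpNormEssSup g (volume.restrict (Icc c d))] with y hy
    rw [← Real.norm_eq_abs, ← toReal_enorm, semi, ← hg]
    rw [eLpNorm_exponent_top] at hfin ⊢
    exact ENNReal.toReal_mono hfin hy
  exact le_of_ae_le_of_continuousOn hcd hgc.abs hae hx

/-! ### Functions with many zeros -/

/-- By Rolle, the `k`-th function of the chain has `n - k` zeros. Going down from `k = n`, the mean
value inequality starting from one zero costs one factor `d - c` per level. -/
lemma abs_le_of_zeros {f : ℕ → ℝ → ℝ} {c d M : ℝ} {n : ℕ}
    (hf : ∀ k < n, ∀ x ∈ Icc c d, HasDerivWithinAt (f k) (f (k + 1) x) (Icc c d) x)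
    {s : Finset ℝ} (hs : ∀ x ∈ s, x ∈ Icc c d ∧ f 0 x = 0) (hcard : s.card = n)
    (hM : ∀ x ∈ Icc c d, |f n x| ≤ M) {k : ℕ} (hk : k ≤ n) {x : ℝ} (hx : x ∈ Icc c d) :
    |f k x| ≤ M * (d - c) ^ (n - k) := by
  have hzeros : ∀ k ≤ n, ∃ t : Finset ℝ, t.card = n - k ∧ ∀ x ∈ t, x ∈ Icc c d ∧ f k x = 0 := by
    intro k
    induction k with
    | zero => exact fun _ => ⟨s, by simpa using hcard, hs⟩
    | succ k ih =>
      intro hk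
      obtain ⟨t, ht, hz⟩ := ih (by omega)
      obtain ⟨t', ht', hz'⟩ := exists_finset_zeros_deriv (n := n - (k + 1))
        (hf k (by omega)) hz (by omega)
      exact ⟨t', ht', fun x hx => ⟨Ioo_subset_Icc_self (hz' x hx).1, (hz' x hx).2⟩⟩
  have hM0 : 0 ≤ M := (abs_nonneg _).trans (hM x hx)
  have hcd : 0 ≤ d - c := sub_nonneg.mpr (hx.1.trans hx.2)
  induction hm : n - k generalizing k x with
  | zero =>
    obtain rfl : k = n := by omega
    simpa using hM x hx
  | succ m ih =>
    obtain ⟨t, ht, hz⟩ := hzeros k hk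
    obtain ⟨y, hy⟩ : t.Nonempty := Finset.card_pos.mp (by omega)
    have := Convex.norm_image_sub_le_of_norm_hasDerivWithin_le (f := f k) (f' := f (k + 1))
      (s := Icc c d) (C := M * (d - c) ^ m) (hf k (by omega))
      (fun z hz => ih (by omega) hz (by omega)) (convex_Icc c d) (hz y hy).1 hx
    rw [(hz y hy).2, sub_zero, Real.norm_eq_abs, Real.norm_eq_abs] at this
    refine this.trans ?_
    rw [pow_succ, ← mul_assoc]
    refine mul_le_mul_of_nonneg_left ?_ (by positivity)
    rw [abs_le]
    have := (hz y hy).1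
    constructor <;> linarith [this.1, this.2, hx.1, hx.2]

/-! ### Interpolation on one element -/

lemma exists_iterate_derivative_eq_C {p : ℝ[X]} {n : ℕ} (hp : p.degree = n) :
    ∃ k : ℝ, k ≠ 0 ∧ derivative^[n] p = C k := by
  induction n generalizing p with
  | zero =>
    refine ⟨p.coeff 0, ?_, eq_C_of_degree_le_zero hp.le⟩
    exact coeff_ne_zero_of_eq_degree hp
  | succ n ih =>
    rw [Function.iterate_succ_apply]
    have hn : p.natDegree = n + 1 := natDegree_eq_of_degree_eq_some hp
    exact ih (by rw [degree_derivative (by omega), hn]; rfl)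

lemma affine_mem_Icc {c d t : ℝ} (hcd : c ≤ d) (ht : t ∈ Icc (-1 : ℝ) 1) :
    (d + c + (d - c) * t) / 2 ∈ Icc c d := by
  have h := ht.1
  have h' := ht.2
  constructor <;> nlinarith

lemma affine_mem_Ioo {c d t : ℝ} (hcd : c < d) (ht : t ∈ Ioo (-1 : ℝ) 1) :
    (d + c + (d - c) * t) / 2 ∈ Ioo c d := by
  have h := ht.1
  have h' := ht.2
  constructor <;> nlinarith

lemma affine_strictMono {c d : ℝ} (hcd : c < d) :
    StrictMono fun t : ℝ => (d + c + (d - c) * t) / 2 := by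
  intro s t hst
  have := mul_lt_mul_of_pos_left hst (sub_pos.mpr hcd)
  simp only
  linarith

lemma hasDerivWithinAt_sub_eval {m : ℕ} {p : ℝ≥0∞} {c d : ℝ} {u : ℝ → ℝ} (hcd : c ≤ d)
    (hu : MemW m p c d u) (q : ℝ[X]) {j : ℕ} (hj : j + 1 < m) {x : ℝ} (hx : x ∈ Icc c d) :
    HasDerivWithinAt (fun y => iteratedDerivWithin j u (Icc c d) y - (derivative^[j] q).eval y)
      (iteratedDerivWithin (j + 1) u (Icc c d) x - (derivative^[j + 1] q).eval x)
      (Icc c d) x := by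
  rw [Function.iterate_succ_apply']
  exact (hu.hasDerivWithinAt hcd hj hx).sub ((derivative^[j] q).hasDerivAt x).hasDerivWithinAt

section Interpolation

variable {r : ℕ} {c d : ℝ} {u : ℝ → ℝ} {p : ℝ[X]}

lemma exists_lobatto_zeros (hr : 1 ≤ r) (hcd : c < d) {f : ℝ → ℝ}
    (hf : ∀ j ≤ r, f ((d + c + (d - c) * lobattoRef r j) / 2) = 0) :
    ∃ s : Finset ℝ, s.card = r + 1 ∧ ∀ x ∈ s, x ∈ Icc c d ∧ f x = 0 := by
  refine ⟨(Finset.range (r + 1)).image fun j => (d + c + (d - c) * lobattoRef r j) / 2, ?_, ?_⟩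
  · rw [Finset.card_image_of_injOn, Finset.card_range]
    intro j hj k hk h
    have h' := (affine_strictMono hcd).injective h
    simp only [Finset.coe_range, mem_Iio] at hj hk
    rcases lt_trichotomy j k with hjk | hjk | hjk
    · exact absurd h' (lobattoRef_lt hr hjk (by omega)).ne
    · exact hjk
    · exact absurd h' (lobattoRef_lt hr hjk (by omega)).ne'
  · intro x hx
    obtain ⟨j, hj, rfl⟩ := Finset.mem_image.mp hx
    have hj' : j ≤ r := by rw [Finset.mem_range] at hj; omega
    exact ⟨affine_mem_Icc hcd.le (lobattoRef_mem hr hj'), hf j hj'⟩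

lemma abs_sub_interpolant_le (hr : 1 ≤ r) (hcd : c < d) (hu : MemW (r + 2) 2 c d u)
    (hp : p.natDegree ≤ r)
    (hint : ∀ j ≤ r, p.eval ((d + c + (d - c) * lobattoRef r j) / 2) =
      u ((d + c + (d - c) * lobattoRef r j) / 2)) {x : ℝ} (hx : x ∈ Icc c d) :
    |u x - p.eval x| ≤ semi (r + 1) ∞ c d u * (d - c) ^ (r + 1) := by
  obtain ⟨s, hs, hz⟩ := exists_lobatto_zeros hr hcd (f := fun x => u x - p.eval x)
    (fun j hj => by rw [hint j hj, sub_self])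
  have := abs_le_of_zeros (n := r + 1) (M := semi (r + 1) ∞ c d u) (k := 0)
    (f := fun k y => iteratedDerivWithin k u (Icc c d) y - (derivative^[k] p).eval y)
    (fun k hk x hx => hasDerivWithinAt_sub_eval hcd.le hu p (by omega) hx)
    (by simpa using hz) hs (fun x hx => by
      rw [iterate_derivative_eq_zero (by omega), eval_zero, sub_zero]
      exact hu.abs_le_semi_top hcd hx) (Nat.zero_le _) hx
  simpa using this

/-- Superconvergence: `p` is replaced by `p + κ φ`, with `φ` the transported Lobatto polynomial. The
correction is invisible at the Lobatto nodes, and so is its derivative at the Gauss points, yet it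
removes the leading term of the error. -/
lemma abs_deriv_sub_interpolant_gauss_le (hr : 1 ≤ r) (hcd : c < d) (hu : MemW (r + 2) 2 c d u)
    (hp : p.natDegree ≤ r)
    (hint : ∀ j ≤ r, p.eval ((d + c + (d - c) * lobattoRef r j) / 2) =
      u ((d + c + (d - c) * lobattoRef r j) / 2)) {j : ℕ} (hj : j ∈ Finset.Icc 1 r) :
    |derivWithin u (Icc c d) ((d + c + (d - c) * gaussRef r j) / 2) -
        (derivative p).eval ((d + c + (d - c) * gaussRef r j) / 2)| ≤
      Real.sqrt (d - c) * semi (r + 2) 2 c d u * (d - c) ^ r := by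
  have hdc : d - c ≠ 0 := (sub_pos.mpr hcd).ne'
  set φ : ℝ[X] := (lobattoPoly r).comp (C (2 / (d - c)) * X + C (-(d + c) / (d - c))) with hφ
  have haff : ∀ t : ℝ, (C (2 / (d - c)) * X + C (-(d + c) / (d - c)) : ℝ[X]).eval
      ((d + c + (d - c) * t) / 2) = t := by
    intro t; simp; field_simp; ring
  have hdeg : φ.natDegree = r + 1 := by
    rw [hφ, natDegree_comp, natDegree_lobattoPoly hr, natDegree_linear (by positivity), mul_one]
  obtain ⟨k, hk, hkφ⟩ := exists_iterate_derivative_eq_C (p := φ) (n := r + 1) (by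
    rw [degree_eq_natDegree (fun h => by rw [h] at hdeg; simp at hdeg), hdeg])
  -- This `κ` makes the constant derivative of order `r + 1` of `p + κ φ` equal to that of `u` at
  -- `c`, so only the increment of `u^{(r+1)}` remains.
  set κ := iteratedDerivWithin (r + 1) u (Icc c d) c / k with hκ
  obtain ⟨s, hs, hz⟩ := exists_lobatto_zeros hr hcd (f := fun x => u x - (p + C κ * φ).eval x)
    (fun j hj => by
      rw [eval_add, eval_mul, hφ, eval_comp, haff, eval_lobattoPoly hr hj, hint j hj]; ring)
  have := abs_le_of_zeros (n := r + 1) (M := Real.sqrt (d - c) * semi (r + 2) 2 c d u) (k := 1)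
    (f := fun k y => iteratedDerivWithin k u (Icc c d) y - (derivative^[k] (p + C κ * φ)).eval y)
    (fun k hk x hx => hasDerivWithinAt_sub_eval hcd.le hu _ (by omega) hx)
    (by simpa using hz) hs (fun x hx => by
      rw [iterate_map_add, iterate_derivative_eq_zero (p := p) (by omega),
        iterate_derivative_C_mul, hkφ, zero_add, ← C_mul, eval_C, hκ, div_mul_cancel₀ _ hk]
      exact hu.abs_sub_le hcd.le hx) (by omega)
    (affine_mem_Icc hcd.le (Ioo_subset_Icc_self (gaussRef_mem hj)))
  have hgauss : (derivative φ).eval ((d + c + (d - c) * gaussRef r j) / 2) = 0 := by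
    rw [hφ, derivative_comp, eval_mul, eval_comp, haff, derivative_lobattoPoly, eval_mul,
      ((gaussRef_spec r).1 j hj).2]
    simp
  simpa [iteratedDerivWithin_one, hgauss] using this

end Interpolation

end FVM

namespace FVM

open Polynomial Set

/-! ### Discrete summation by parts and geometry of the mesh -/

lemma sum_Icc_one_eq_sum_range (N : ℕ) (f : ℕ → ℝ) :
    ∑ i ∈ Finset.Icc 1 N, f i = ∑ i ∈ Finset.range N, f (i + 1) := by
  induction N with
  | zero => simp
  | succ N ih => rw [Finset.sum_Icc_succ_top (by omega), Finset.sum_range_succ, ih]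

/-- Summation by parts over a double index, the index `(i, r + 1)` being identified with
`(i + 1, 1)` for `F`, and `(i, r)` with `(i + 1, 0)` for `e`. -/
lemma sum_sub_mul_eq_neg_sum_mul_sub {N r : ℕ} (e F : ℕ → ℕ → ℝ) (h0 : e 1 0 = 0)
    (hN : e N r = 0) (he : ∀ i, 1 ≤ i → i < N → e (i + 1) 0 = e i r)
    (hF : ∀ i, 1 ≤ i → i < N → F i (r + 1) = F (i + 1) 1) :
    ∑ i ∈ Finset.Icc 1 N, ∑ j ∈ Finset.Icc 1 r, (e i j - e i (j - 1)) * F i j =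
      -∑ i ∈ Finset.Icc 1 N, ∑ j ∈ Finset.Icc 1 r, e i j * (F i (j + 1) - F i j) := by
  have hrow : ∀ i, ∑ j ∈ Finset.Icc 1 r, (e i j - e i (j - 1)) * F i j +
      ∑ j ∈ Finset.Icc 1 r, e i j * (F i (j + 1) - F i j) =
      e i r * F i (r + 1) - e i 0 * F i 1 := by
    intro i
    have : ∀ n, ∑ j ∈ Finset.Icc 1 n, (e i j - e i (j - 1)) * F i j +
        ∑ j ∈ Finset.Icc 1 n, e i j * (F i (j + 1) - F i j) =
        e i n * F i (n + 1) - e i 0 * F i 1 := by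
      intro n
      induction n with
      | zero => simp
      | succ n ih =>
        rw [Finset.sum_Icc_succ_top (by omega), Finset.sum_Icc_succ_top (by omega),
          Nat.add_sub_cancel]
        linear_combination ih
    exact this r
  -- The boundary terms of consecutive elements cancel, so only the last right end survives, and it
  -- vanishes by `hN`.
  have hcol : ∀ M, 1 ≤ M → M ≤ N →
      ∑ i ∈ Finset.Icc 1 M, (e i r * F i (r + 1) - e i 0 * F i 1) = e M r * F M (r + 1) := by
    intro M hM
    induction M, hM using Nat.le_induction with
    | base => intro _; simp [h0]
    | succ M hM ih =>
      intro hMN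
      rw [Finset.sum_Icc_succ_top (by omega), ih (by omega), he M hM (by omega),
        hF M hM (by omega)]
      ring
  rw [eq_neg_iff_add_eq_zero, ← Finset.sum_add_distrib, Finset.sum_congr rfl fun i _ => hrow i]
  rcases Nat.eq_zero_or_pos N with rfl | hN0
  · simp
  · rw [hcol N hN0 le_rfl, hN, zero_mul]

namespace Mesh

variable {a b : ℝ} (P : Mesh a b) {r i j : ℕ}

lemma x_strictMono {k : ℕ} (hij : i < k) (hk : k ≤ P.N) : P.x i < P.x k := by
  induction k, hij using Nat.le_induction with
  | base => exact P.x_lt i hk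
  | succ k hik ih => exact (ih (by omega)).trans (P.x_lt k hk)

lemma x_mono {k : ℕ} (hij : i ≤ k) (hk : k ≤ P.N) : P.x i ≤ P.x k := by
  rcases hij.eq_or_lt with rfl | h
  · exact le_rfl
  · exact (P.x_strictMono h hk).le

lemma x_mem (hi : i ≤ P.N) : P.x i ∈ Icc a b := by
  constructor
  · exact P.x_zero.symm.trans_le (P.x_mono (Nat.zero_le _) hi)
  · exact (P.x_mono hi le_rfl).trans_eq P.x_N

lemma lt (P : Mesh a b) : a < b :=
  P.x_zero.symm.trans_lt ((P.x_strictMono P.one_le_N le_rfl).trans_eq P.x_N)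

lemma x_pred_lt (hi : i ∈ Finset.Icc 1 P.N) : P.x (i - 1) < P.x i := by
  rw [Finset.mem_Icc] at hi
  exact P.x_strictMono (by omega) hi.2

lemma x_pred_mem (hi : i ∈ Finset.Icc 1 P.N) : P.x (i - 1) ∈ Icc a b := by
  rw [Finset.mem_Icc] at hi
  exact P.x_mem (by omega)

lemma x_mem' (hi : i ∈ Finset.Icc 1 P.N) : P.x i ∈ Icc a b :=
  P.x_mem (Finset.mem_Icc.mp hi).2

lemma Icc_subset (hi : i ∈ Finset.Icc 1 P.N) : Icc (P.x (i - 1)) (P.x i) ⊆ Icc a b :=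
  Icc_subset_Icc (P.x_pred_mem hi).1 (P.x_mem' hi).2

lemma Ioo_subset (hi : i ∈ Finset.Icc 1 P.N) : Ioo (P.x (i - 1)) (P.x i) ⊆ Ioo a b :=
  Ioo_subset_Ioo (P.x_pred_mem hi).1 (P.x_mem' hi).2

lemma len_pos (hi : i ∈ Finset.Icc 1 P.N) : 0 < P.len i := sub_pos.mpr (P.x_pred_lt hi)

lemma le_maxOver (F : ℕ → ℝ) (hi : i ∈ Finset.Icc 1 P.N) : F i ≤ P.maxOver F :=
  Finset.le_sup' F hi

lemma len_le_h (hi : i ∈ Finset.Icc 1 P.N) : P.len i ≤ P.h := P.le_maxOver _ hi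

lemma h_pos : 0 < P.h := by
  have h1 : 1 ∈ Finset.Icc 1 P.N := Finset.mem_Icc.mpr ⟨le_rfl, P.one_le_N⟩
  exact (P.len_pos h1).trans_le (P.len_le_h h1)

lemma sum_len : ∑ i ∈ Finset.Icc 1 P.N, P.len i = b - a := by
  rw [sum_Icc_one_eq_sum_range]
  have h := Finset.sum_range_sub P.x P.N
  rw [P.x_zero, P.x_N] at h
  exact h

lemma exists_mem_Icc {y : ℝ} (hy : y ∈ Icc a b) :
    ∃ i ∈ Finset.Icc 1 P.N, y ∈ Icc (P.x (i - 1)) (P.x i) := by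
  have key : ∀ M, 1 ≤ M → M ≤ P.N → y ≤ P.x M →
      ∃ i ∈ Finset.Icc 1 P.N, y ∈ Icc (P.x (i - 1)) (P.x i) := by
    intro M hM
    induction M, hM using Nat.le_induction with
    | base =>
      intro hM hyM
      exact ⟨1, Finset.mem_Icc.mpr ⟨le_rfl, hM⟩, by simpa [P.x_zero] using hy.1, hyM⟩
    | succ M hM ih =>
      intro hMN hyM
      rcases le_total y (P.x M) with h | h
      · exact ih (by omega) h
      · exact ⟨M + 1, Finset.mem_Icc.mpr ⟨by omega, hMN⟩, by simpa using h, hyM⟩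
  exact key P.N P.one_le_N le_rfl (by rw [P.x_N]; exact hy.2)

lemma exists_mem_Ioo {y : ℝ} (hy : y ∈ Icc a b) (hy' : ∀ i ≤ P.N, y ≠ P.x i) :
    ∃ i ∈ Finset.Icc 1 P.N, y ∈ Ioo (P.x (i - 1)) (P.x i) := by
  obtain ⟨i, hi, h⟩ := P.exists_mem_Icc hy
  have hi' := Finset.mem_Icc.mp hi
  exact ⟨i, hi, lt_of_le_of_ne h.1 (hy' (i - 1) (by omega)).symm,
    lt_of_le_of_ne h.2 (hy' i hi'.2)⟩

lemma intervalIntegrable_of_forall {f : ℝ → ℝ}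
    (hf : ∀ i ∈ Finset.Icc 1 P.N, IntervalIntegrable f volume (P.x (i - 1)) (P.x i)) :
    IntervalIntegrable f volume a b := by
  have h : IntervalIntegrable f volume (P.x 0) (P.x P.N) := by
    refine IntervalIntegrable.trans_iterate fun k hk => ?_
    simpa using hf (k + 1) (Finset.mem_Icc.mpr ⟨by omega, hk⟩)
  rwa [P.x_zero, P.x_N] at h

lemma intervalIntegrable_element {f : ℝ → ℝ} (hf : IntervalIntegrable f volume a b)
    (hi : i ∈ Finset.Icc 1 P.N) : IntervalIntegrable f volume (P.x (i - 1)) (P.x i) :=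
  hf.mono_set (by
    rw [uIcc_of_le (P.x_pred_lt hi).le, uIcc_of_le P.lt.le]; exact P.Icc_subset hi)

lemma sum_integral {f : ℝ → ℝ} (hf : IntervalIntegrable f volume a b) :
    ∑ i ∈ Finset.Icc 1 P.N, ∫ y in (P.x (i - 1))..(P.x i), f y = ∫ y in a..b, f y := by
  rw [sum_Icc_one_eq_sum_range]
  have := intervalIntegral.sum_integral_adjacent_intervals (f := f) (μ := volume) (a := P.x)
    (n := P.N) (fun k hk => by
      simpa using P.intervalIntegrable_element hf (i := k + 1)
        (Finset.mem_Icc.mpr ⟨by omega, hk⟩))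
  rw [P.x_zero, P.x_N] at this
  simpa using this

lemma gauss_eq (hj : j ∈ Finset.Icc 1 r) : P.gauss r i j =
    (P.x i + P.x (i - 1) + (P.x i - P.x (i - 1)) * gaussRef r j) / 2 := by
  rw [Finset.mem_Icc] at hj
  rw [gauss, if_neg (by omega)]
  rfl

lemma gauss_mem_Ioo (hi : i ∈ Finset.Icc 1 P.N) (hj : j ∈ Finset.Icc 1 r) :
    P.gauss r i j ∈ Ioo (P.x (i - 1)) (P.x i) := by
  rw [P.gauss_eq hj]
  exact affine_mem_Ioo (P.x_pred_lt hi) (gaussRef_mem hj)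

lemma gauss_mem (hi : i ∈ Finset.Icc 1 P.N) (hj : j ∈ Finset.Icc 1 r) :
    P.gauss r i j ∈ Icc a b :=
  P.Icc_subset hi (Ioo_subset_Icc_self (P.gauss_mem_Ioo hi hj))

lemma gauss_succ_last (hr : 1 ≤ r) : P.gauss r i (r + 1) = P.gauss r (i + 1) 1 := by
  rw [gauss, if_pos rfl, gauss, if_neg (by omega)]

lemma rank_le : P.rank r i ≤ r := by
  unfold rank; split_ifs <;> omega

lemma mem_Icc_of_mem_rank (hj : j ∈ Finset.Icc 1 (P.rank r i)) : j ∈ Finset.Icc 1 r :=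
  Finset.Icc_subset_Icc_right P.rank_le hj

lemma gauss_succ_mem (hi : i ∈ Finset.Icc 1 P.N) (hj : j ∈ Finset.Icc 1 (P.rank r i)) :
    P.gauss r i (j + 1) ∈ Icc a b ∧ P.gauss r i j ≤ P.gauss r i (j + 1) := by
  have hj' := P.mem_Icc_of_mem_rank hj
  have hjr := Finset.mem_Icc.mp hj'
  have hi' := Finset.mem_Icc.mp hi
  by_cases hlast : j = r
  · subst hlast
    -- The cell that starts at the last Gauss point of an element crosses into the next one; in the
    -- last element it is excluded by `r_N = r - 1`.
    have hiN : i ≠ P.N := by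
      rintro rfl
      have := (Finset.mem_Icc.mp hj).2
      simp only [rank, if_true] at this
      omega
    have hi1 : i + 1 ∈ Finset.Icc 1 P.N := Finset.mem_Icc.mpr (by omega)
    have h1 : 1 ∈ Finset.Icc 1 j := Finset.mem_Icc.mpr (by omega)
    rw [P.gauss_succ_last hjr.1]
    exact ⟨P.gauss_mem hi1 h1,
      (P.gauss_mem_Ioo hi hj').2.le.trans (by simpa using (P.gauss_mem_Ioo hi1 h1).1.le)⟩
  · have hj1 : j + 1 ∈ Finset.Icc 1 r := Finset.mem_Icc.mpr (by omega)
    refine ⟨P.gauss_mem hi hj1, ?_⟩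
    rw [P.gauss_eq hj', P.gauss_eq hj1]
    exact ((affine_strictMono (P.x_pred_lt hi)) ((gaussRef_spec r).2 j (j + 1) hjr.1
      (by omega) (by omega))).le

/-! ### Summation by parts on the mesh -/

lemma ext_last (hr : 1 ≤ r) (w : ℕ → ℕ → ℝ) : P.ext r w P.N r = 0 := by
  rw [ext, if_neg (by omega), if_pos ⟨rfl, rfl⟩]

/-- The one index added in the last element carries the conventional coefficient `w_{N,r} = 0`; this
makes the double sum rectangular. -/
lemma sum_rank_eq (hr : 1 ≤ r) (w X : ℕ → ℕ → ℝ) :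
    ∑ i ∈ Finset.Icc 1 P.N, ∑ j ∈ Finset.Icc 1 (P.rank r i), w i j * X i j =
      ∑ i ∈ Finset.Icc 1 P.N, ∑ j ∈ Finset.Icc 1 r, P.ext r w i j * X i j := by
  refine Finset.sum_congr rfl fun i _ => ?_
  by_cases hi : i = P.N
  · obtain ⟨s, rfl⟩ : ∃ s, r = s + 1 := ⟨r - 1, by omega⟩
    rw [rank, if_pos hi, Nat.add_sub_cancel, Finset.sum_Icc_succ_top (by omega), hi,
      P.ext_last hr, zero_mul, add_zero]
    refine Finset.sum_congr rfl fun j hj => ?_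
    rw [Finset.mem_Icc] at hj
    rw [ext, if_neg (by omega), if_neg (by omega)]
  · rw [rank, if_neg hi]
    refine Finset.sum_congr rfl fun j hj => ?_
    rw [Finset.mem_Icc] at hj
    rw [ext, if_neg (by omega), if_neg (by omega)]

lemma sum_jump_mul (hr : 1 ≤ r) (w : ℕ → ℕ → ℝ) (Φ : ℝ → ℝ) :
    ∑ i ∈ Finset.Icc 1 P.N, ∑ j ∈ Finset.Icc 1 r, P.jump r w i j * Φ (P.gauss r i j) =
      -∑ i ∈ Finset.Icc 1 P.N, ∑ j ∈ Finset.Icc 1 (P.rank r i),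
        w i j * (Φ (P.gauss r i (j + 1)) - Φ (P.gauss r i j)) := by
  rw [P.sum_rank_eq hr]
  refine sum_sub_mul_eq_neg_sum_mul_sub (P.ext r w) (fun i j => Φ (P.gauss r i j)) ?_ ?_ ?_ ?_
  · simp [ext]
  · exact P.ext_last hr w
  · intro i hi hiN
    rw [ext, if_pos rfl, if_neg (by omega), ext, if_neg (by omega), if_neg (by omega),
      Nat.add_sub_cancel]
  · intro i _ _
    simp only [P.gauss_succ_last hr]

lemma sum_mul_integral (hr : 1 ≤ r) (w : ℕ → ℕ → ℝ) {f : ℝ → ℝ}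
    (hf : IntervalIntegrable f volume a b) :
    ∑ i ∈ Finset.Icc 1 P.N, ∑ j ∈ Finset.Icc 1 (P.rank r i),
        w i j * ∫ y in (P.gauss r i j)..(P.gauss r i (j + 1)), f y =
      -∑ i ∈ Finset.Icc 1 P.N, ∑ j ∈ Finset.Icc 1 r,
        P.jump r w i j * ∫ y in a..(P.gauss r i j), f y := by
  rw [P.sum_jump_mul hr w (fun x => ∫ y in a..x, f y), neg_neg]
  refine Finset.sum_congr rfl fun i hi => Finset.sum_congr rfl fun j hj => ?_
  have hsub : ∀ y ∈ Icc a b, IntervalIntegrable f volume a y := fun y hy =>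
    hf.mono_set (by rw [uIcc_of_le hy.1, uIcc_of_le P.lt.le]; exact Icc_subset_Icc_right hy.2)
  rw [intervalIntegral.integral_interval_sub_left (hsub _ (P.gauss_succ_mem hi hj).1)
    (hsub _ (P.gauss_mem hi (P.mem_Icc_of_mem_rank hj)))]

lemma integral_mul_testFun (hr : 1 ≤ r) (w : ℕ → ℕ → ℝ) {f : ℝ → ℝ}
    (hf : IntervalIntegrable f volume a b) :
    ∫ y in a..b, f y * P.testFun r w y =
      -∑ i ∈ Finset.Icc 1 P.N, ∑ j ∈ Finset.Icc 1 r,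
        P.jump r w i j * ∫ y in a..(P.gauss r i j), f y := by
  rw [← P.sum_mul_integral hr w hf, intervalIntegral.integral_of_le P.lt.le,
    ← integral_Icc_eq_integral_Ioc]
  have hfI : IntegrableOn f (Icc a b) :=
    (intervalIntegrable_iff_integrableOn_Icc_of_le P.lt.le).mp hf
  have hterm : ∀ y, f y * P.testFun r w y =
      ∑ i ∈ Finset.Icc 1 P.N, ∑ j ∈ Finset.Icc 1 (P.rank r i),
        w i j * (Icc (P.gauss r i j) (P.gauss r i (j + 1))).indicator f y := by
    intro y
    rw [testFun, Finset.mul_sum]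
    refine Finset.sum_congr rfl fun i _ => ?_
    rw [Finset.mul_sum]
    refine Finset.sum_congr rfl fun j _ => ?_
    by_cases hy : y ∈ Icc (P.gauss r i j) (P.gauss r i (j + 1))
    · simp only [indicator_of_mem hy, Pi.one_apply]; ring
    · simp only [indicator_of_notMem hy]; ring
  have hint : ∀ i j, Integrable (fun y => w i j *
      (Icc (P.gauss r i j) (P.gauss r i (j + 1))).indicator f y) (volume.restrict (Icc a b)) :=
    fun i j => (hfI.indicator measurableSet_Icc).const_mul _
  simp only [hterm]
  rw [integral_finsetSum _ fun i _ => integrable_finsetSum _ fun j _ => hint i j]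
  refine Finset.sum_congr rfl fun i hi => ?_
  rw [integral_finsetSum _ fun j _ => hint i j]
  refine Finset.sum_congr rfl fun j hj => ?_
  have hg := P.gauss_succ_mem hi hj
  have hg' := P.gauss_mem hi (P.mem_Icc_of_mem_rank hj)
  rw [integral_const_mul, setIntegral_indicator measurableSet_Icc,
    inter_eq_self_of_subset_right (Icc_subset_Icc hg'.1 hg.1.2),
    intervalIntegral.integral_of_le hg.2, integral_Icc_eq_integral_Ioc]

/-- Summation by parts against the primitive of the lower order terms collects the whole form on the
jumps. Consistency, stability and exactness for solutions all start from this formula. -/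
lemma bilin_eq (hr : 1 ≤ r) {α β γ v : ℝ → ℝ} (w : ℕ → ℕ → ℝ)
    (hf : IntervalIntegrable (fun y => β y * deriv v y + γ y * v y) volume a b) :
    P.bilin r α β γ v w = ∑ i ∈ Finset.Icc 1 P.N, ∑ j ∈ Finset.Icc 1 r,
      P.jump r w i j * (α (P.gauss r i j) * deriv v (P.gauss r i j) -
        ∫ y in a..(P.gauss r i j), (β y * deriv v y + γ y * v y)) := by
  rw [bilin, P.sum_mul_integral hr w hf, ← sub_eq_add_neg, ← Finset.sum_sub_distrib]
  refine Finset.sum_congr rfl fun i _ => ?_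
  rw [← Finset.sum_sub_distrib]
  exact Finset.sum_congr rfl fun j _ => by ring

/-! ### The seminorm of jumps -/

/-- The seminorm `|w|_{1,P'}` given by the jumps of `w`. -/
noncomputable def jumpNorm (r : ℕ) (w : ℕ → ℕ → ℝ) : ℝ :=
  Real.sqrt (∑ i ∈ Finset.Icc 1 P.N, ∑ j ∈ Finset.Icc 1 r, (P.len i)⁻¹ * P.jump r w i j ^ 2)

lemma jumpNorm_le_testNorm (w : ℕ → ℕ → ℝ) : P.jumpNorm r w ≤ P.testNorm r w := by
  refine Real.sqrt_le_sqrt (le_add_of_nonneg_right ?_)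
  exact Finset.sum_nonneg fun i hi => Finset.sum_nonneg fun j _ =>
    mul_nonneg (P.len_pos hi).le (sq_nonneg _)

/-- Cauchy–Schwarz with the weights `h_i^{-1/2}` and `h_i^{1/2}`; the factor `r` counts the Gauss
points of an element. -/
lemma sum_abs_jump_mul_le (w : ℕ → ℕ → ℝ) (B : ℕ → ℝ) :
    ∑ i ∈ Finset.Icc 1 P.N, ∑ j ∈ Finset.Icc 1 r, |P.jump r w i j| * B i ≤
      P.jumpNorm r w * Real.sqrt (r * ∑ i ∈ Finset.Icc 1 P.N, P.len i * B i ^ 2) := by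
  have h := Real.sum_mul_le_sqrt_mul_sqrt (Finset.Icc 1 P.N ×ˢ Finset.Icc 1 r)
    (fun q => (Real.sqrt (P.len q.1))⁻¹ * |P.jump r w q.1 q.2|)
    (fun q => Real.sqrt (P.len q.1) * B q.1)
  simp only [Finset.sum_product] at h
  refine le_trans (le_of_eq ?_) (h.trans (le_of_eq ?_))
  · refine Finset.sum_congr rfl fun i hi => Finset.sum_congr rfl fun j _ => ?_
    have := (Real.sqrt_pos.mpr (P.len_pos hi)).ne'
    field_simp
  · congr 1
    · rw [jumpNorm]
      congr 1
      refine Finset.sum_congr rfl fun i hi => Finset.sum_congr rfl fun j _ => ?_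
      rw [mul_pow, inv_pow, Real.sq_sqrt (P.len_pos hi).le, sq_abs]
    · congr 1
      rw [Finset.mul_sum]
      refine Finset.sum_congr rfl fun i hi => ?_
      rw [Finset.sum_const, Nat.card_Icc, Nat.add_sub_cancel, nsmul_eq_mul, mul_pow,
        Real.sq_sqrt (P.len_pos hi).le]

lemma sum_abs_jump_le (w : ℕ → ℕ → ℝ) :
    ∑ i ∈ Finset.Icc 1 P.N, ∑ j ∈ Finset.Icc 1 r, |P.jump r w i j| ≤
      P.jumpNorm r w * Real.sqrt (r * (b - a)) := by
  simpa [P.sum_len] using P.sum_abs_jump_mul_le (r := r) w (fun _ => 1)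

lemma brokenSemi_two (m : ℕ) (u : ℝ → ℝ) : P.brokenSemi m 2 u =
    Real.sqrt (∑ i ∈ Finset.Icc 1 P.N, semi m 2 (P.x (i - 1)) (P.x i) u ^ 2) := by
  rw [brokenSemi, if_neg (by norm_num), Real.sqrt_eq_rpow, ENNReal.toReal_ofNat]
  simp only [Real.rpow_ofNat]

lemma semi_le_brokenSemi_top (m : ℕ) (u : ℝ → ℝ) (hi : i ∈ Finset.Icc 1 P.N) :
    semi m ∞ (P.x (i - 1)) (P.x i) u ≤ P.brokenSemi m ∞ u := by
  rw [brokenSemi, if_pos rfl]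
  exact P.le_maxOver (fun i => semi m ∞ (P.x (i - 1)) (P.x i) u) hi

lemma brokenSemi_top_nonneg (m : ℕ) (u : ℝ → ℝ) : 0 ≤ P.brokenSemi m ∞ u :=
  (ENNReal.toReal_nonneg).trans
    (P.semi_le_brokenSemi_top m u (i := 1) (Finset.mem_Icc.mpr ⟨le_rfl, P.one_le_N⟩))

end Mesh

end FVM

namespace FVM

open Polynomial Set

/-! ### Absolutely continuous functions and their integrals -/

lemma absolutelyContinuousOnInterval_congr {f g : ℝ → ℝ} {a b : ℝ}
    (hf : AbsolutelyContinuousOnInterval f a b) (h : EqOn f g (uIcc a b)) :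
    AbsolutelyContinuousOnInterval g a b := by
  rw [absolutelyContinuousOnInterval_iff] at hf ⊢
  intro ε hε
  obtain ⟨δ, hδ, H⟩ := hf ε hε
  refine ⟨δ, hδ, fun E hE hlt => ?_⟩
  refine (Finset.sum_congr rfl fun i hi => ?_).trans_lt (H E hE hlt)
  rw [h (hE.1 i hi).1, h (hE.1 i hi).2]

lemma ae_deriv_sub {f g : ℝ → ℝ} {a b : ℝ} (hf : AbsolutelyContinuousOnInterval f a b)
    (hg : AbsolutelyContinuousOnInterval g a b) :
    ∀ᵐ x ∂volume, x ∈ uIcc a b → deriv (fun y => f y - g y) x = deriv f x - deriv g x := by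
  filter_upwards [hf.ae_differentiableAt, hg.ae_differentiableAt] with x h1 h2 hx
  exact deriv_fun_sub (h1 hx) (h2 hx)

lemma intervalIntegrable_prefix {f : ℝ → ℝ} {a b x : ℝ} (hf : IntervalIntegrable f volume a b)
    (hx : x ∈ Icc a b) : IntervalIntegrable f volume a x :=
  hf.mono_set (by
    rw [uIcc_of_le hx.1, uIcc_of_le (hx.1.trans hx.2)]; exact Icc_subset_Icc_right hx.2)

lemma MemW.absolutelyContinuousOnInterval {p : ℝ≥0∞} {m : ℕ} {a b : ℝ} {u : ℝ → ℝ}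
    (hu : MemW (m + 1) p a b u) : AbsolutelyContinuousOnInterval u a b := by
  simpa using hu.1 0 (Nat.succ_pos m)

/-! ### Bounds for the coefficients and the lower order terms -/

namespace Coefficients

variable {a b α₀ κ Λ : ℝ} {α β γ : ℝ → ℝ}

lemma upper_pos (hC : Coefficients a b α₀ κ Λ α β γ) (hab : a < b) (hα₀ : 0 < α₀) : 0 < Λ := by
  have hm : (a + b) / 2 ∈ Ioo a b := ⟨by linarith, by linarith⟩
  exact hα₀.trans_le ((hC.α_lower _ hm).trans (hC.α_upper _ hm))

lemma abs_α_le (hC : Coefficients a b α₀ κ Λ α β γ) (hα₀ : 0 < α₀) {x : ℝ} (hx : x ∈ Ioo a b) :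
    |α x| ≤ Λ :=
  abs_le.mpr ⟨by linarith [hC.α_lower x hx, hC.α_upper x hx], hC.α_upper x hx⟩

lemma abs_β_le (hC : Coefficients a b α₀ κ Λ α β γ) (hab : a < b) {x : ℝ} (hx : x ∈ Icc a b) :
    |β x| ≤ Λ := by
  have hc := hC.β_ac.continuousOn
  rw [uIcc_of_le hab.le] at hc
  refine le_of_ae_le_of_continuousOn hab hc.abs ?_ hx
  rw [← restrict_Ioo_eq_restrict_Icc]
  exact ae_restrict_of_forall_mem measurableSet_Ioo hC.β_bound

lemma intervalIntegrable_γ_mul (hC : Coefficients a b α₀ κ Λ α β γ) (hab : a < b) {g : ℝ → ℝ}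
    (hg : IntervalIntegrable g volume a b) :
    IntervalIntegrable (fun x => γ x * g x) volume a b := by
  rw [intervalIntegrable_iff_integrableOn_Icc_of_le hab.le] at hg ⊢
  exact hg.bdd_mul hC.γ_meas (c := Λ) (by simpa [Real.norm_eq_abs] using hC.γ_bound)

lemma intervalIntegrable_β_mul_deriv (hC : Coefficients a b α₀ κ Λ α β γ) {v : ℝ → ℝ}
    (hv : AbsolutelyContinuousOnInterval v a b) :
    IntervalIntegrable (fun x => β x * deriv v x) volume a b :=
  hv.intervalIntegrable_deriv.continuousOn_mul hC.β_ac.continuousOn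

lemma intervalIntegrable_lower (hC : Coefficients a b α₀ κ Λ α β γ) (hab : a < b) {v : ℝ → ℝ}
    (hv : AbsolutelyContinuousOnInterval v a b) :
    IntervalIntegrable (fun x => β x * deriv v x + γ x * v x) volume a b :=
  (hC.intervalIntegrable_β_mul_deriv hv).add
    (hC.intervalIntegrable_γ_mul hab hv.continuousOn.intervalIntegrable)

/-- Coercivity and `γ ≤ Λ` give `β' ≤ 2 Λ` almost everywhere, hence `|β'| ≤ 4 Λ - β'`. The integral
of the right side involves only the end values of `β`. -/
lemma integral_abs_deriv_β_le (hC : Coefficients a b α₀ κ Λ α β γ) (hab : a < b) (hκ : 0 < κ) :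
    ∫ x in a..b, |deriv β x| ≤ Λ * (2 + 4 * (b - a)) := by
  have hi := hC.β_ac.intervalIntegrable_deriv
  have h1 : ∫ x in a..b, |deriv β x| ≤ ∫ x in a..b, (4 * Λ - deriv β x) := by
    refine intervalIntegral.integral_mono_ae_restrict hab.le hi.abs (intervalIntegrable_const.sub hi) ?_
    filter_upwards [hC.γ_bound, hC.coercive] with x h1 h2
    have h3 := abs_le.mp h1
    rw [abs_le]
    constructor <;> linarith [h3.1, h3.2]
  rw [intervalIntegral.integral_sub (by simp) hi, hC.β_ac.integral_deriv_eq_sub,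
    intervalIntegral.integral_const, smul_eq_mul] at h1
  have h2 := abs_le.mp (hC.abs_β_le hab (left_mem_Icc.mpr hab.le))
  have h3 := abs_le.mp (hC.abs_β_le hab (right_mem_Icc.mpr hab.le))
  linarith [h2.1, h2.2, h3.1, h3.2]

/-- Integration by parts removes the derivative of `v`, which in the application is one order worse
than `v`. The constant adds up the contributions of `β v`, `β' v` and `γ v`. -/
lemma abs_integral_lower_le (hC : Coefficients a b α₀ κ Λ α β γ) (hab : a < b) (hα₀ : 0 < α₀)
    (hκ : 0 < κ) {v : ℝ → ℝ} (hv : AbsolutelyContinuousOnInterval v a b) (hva : v a = 0) {E : ℝ}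
    (hE : ∀ x ∈ Icc a b, |v x| ≤ E) {x : ℝ} (hx : x ∈ Icc a b) :
    |∫ y in a..x, (β y * deriv v y + γ y * v y)| ≤ Λ * (3 + 5 * (b - a)) * E := by
  have hΛ := hC.upper_pos hab hα₀
  have hE0 : 0 ≤ E := (abs_nonneg _).trans (hE x hx)
  have hsub : uIcc a x ⊆ uIcc a b := by
    rw [uIcc_of_le hx.1, uIcc_of_le hab.le]; exact Icc_subset_Icc_right hx.2
  have hγ := hC.intervalIntegrable_γ_mul hab hv.continuousOn.intervalIntegrable
  rw [intervalIntegral.integral_add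
    (intervalIntegrable_prefix (hC.intervalIntegrable_β_mul_deriv hv) hx)
    (intervalIntegrable_prefix hγ hx),
    (hC.β_ac.mono hsub).integral_mul_deriv_eq_deriv_mul (hv.mono hsub), hva, mul_zero, sub_zero]
  have h1 : |β x * v x| ≤ Λ * E := by
    rw [abs_mul]
    exact mul_le_mul (hC.abs_β_le hab hx) (hE x hx) (abs_nonneg _) hΛ.le
  have h2 : |∫ y in a..x, deriv β y * v y| ≤ Λ * (2 + 4 * (b - a)) * E := by
    have hi := hC.β_ac.intervalIntegrable_deriv
    calc |∫ y in a..x, deriv β y * v y| ≤ ∫ y in a..x, |deriv β y * v y| :=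
          intervalIntegral.abs_integral_le_integral_abs hx.1
      _ ≤ ∫ y in a..b, |deriv β y * v y| :=
          intervalIntegral.integral_mono_interval le_rfl hx.1 hx.2
            (Filter.Eventually.of_forall fun t => abs_nonneg _)
            (hi.mul_continuousOn hv.continuousOn).abs
      _ ≤ ∫ y in a..b, |deriv β y| * E := by
          refine intervalIntegral.integral_mono_on hab.le
            (hi.mul_continuousOn hv.continuousOn).abs (hi.abs.mul_const _) fun y hy => ?_
          rw [abs_mul]
          exact mul_le_mul_of_nonneg_left (hE y hy) (abs_nonneg _)
      _ ≤ Λ * (2 + 4 * (b - a)) * E := by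
          rw [intervalIntegral.integral_mul_const]
          exact mul_le_mul_of_nonneg_right (hC.integral_abs_deriv_β_le hab hκ) hE0
  have h3 : |∫ y in a..x, γ y * v y| ≤ Λ * (b - a) * E := by
    calc |∫ y in a..x, γ y * v y| ≤ ∫ y in a..x, |γ y * v y| :=
          intervalIntegral.abs_integral_le_integral_abs hx.1
      _ ≤ ∫ y in a..b, |γ y * v y| :=
          intervalIntegral.integral_mono_interval le_rfl hx.1 hx.2
            (Filter.Eventually.of_forall fun t => abs_nonneg _) hγ.abs
      _ ≤ ∫ _ in a..b, Λ * E := by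
          refine intervalIntegral.integral_mono_ae_restrict hab.le hγ.abs (by simp) ?_
          filter_upwards [hC.γ_bound, ae_restrict_mem measurableSet_Icc] with y hy hym
          rw [abs_mul]
          exact mul_le_mul hy (hE y hym) (abs_nonneg _) hΛ.le
      _ = Λ * (b - a) * E := by
          rw [intervalIntegral.integral_const, smul_eq_mul]; ring
  calc _ ≤ |β x * v x| + |∫ y in a..x, deriv β y * v y| + |∫ y in a..x, γ y * v y| :=
        (abs_add_le _ _).trans (add_le_add_left (abs_sub _ _) _)
    _ ≤ Λ * (3 + 5 * (b - a)) * E := by linarith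

end Coefficients

namespace Mesh

variable {a b : ℝ} {P : Mesh a b} {r i j : ℕ} {u v uI : ℝ → ℝ}

/-! ### Trial functions -/

lemma hasDerivAt_of_eq_eval {p : ℝ[X]}
    (hp : ∀ y ∈ Icc (P.x (i - 1)) (P.x i), v y = p.eval y) {y : ℝ}
    (hy : y ∈ Ioo (P.x (i - 1)) (P.x i)) : HasDerivAt v ((derivative p).eval y) y :=
  (p.hasDerivAt y).congr_of_eventuallyEq
    (Filter.eventually_of_mem (Icc_mem_nhds hy.1 hy.2) hp)

namespace IsTrial

lemma intervalIntegrable_comp_deriv (hv : P.IsTrial r v) {φ : ℝ → ℝ} (hφ : Continuous φ) :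
    IntervalIntegrable (fun y => φ (deriv v y)) volume a b := by
  refine P.intervalIntegrable_of_forall fun i hi => ?_
  obtain ⟨p, -, hp⟩ := hv.2.2.2 i hi
  refine IntervalIntegrable.congr_uIoo (f := fun y => φ ((derivative p).eval y))
    ((hφ.comp (derivative p).continuous).intervalIntegrable _ _) fun y hy => ?_
  rw [uIoo_of_le (P.x_pred_lt hi).le] at hy
  simp only [(hasDerivAt_of_eq_eval hp hy).deriv]

lemma absolutelyContinuousOnInterval (hv : P.IsTrial r v) :
    AbsolutelyContinuousOnInterval v a b := by
  have hint : IntervalIntegrable (deriv v) volume a b :=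
    hv.intervalIntegrable_comp_deriv continuous_id
  have hab := P.lt.le
  have h1 := hint.absolutelyContinuousOnInterval_intervalIntegral (c := a) left_mem_uIcc
  have h2 : AbsolutelyContinuousOnInterval (fun _ : ℝ => v a) a b :=
    contDiffOn_const.absolutelyContinuousOnInterval
  refine absolutelyContinuousOnInterval_congr (h2.add h1) fun x hx => ?_
  rw [uIcc_of_le hab] at hx
  -- Only at the mesh points may the derivative fail to exist, and the fundamental theorem tolerates
  -- a countable exceptional set.
  have hS : ((fun i => P.x i) '' (Set.Iic P.N)).Countable := ((Set.finite_Iic P.N).image _).countable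
  have := integral_eq_of_hasDerivAt_off_countable_of_le v (deriv v) hx.1 hS
    (hv.1.mono (Icc_subset_Icc_right hx.2)) (fun y hy => by
      have hyab : y ∈ Icc a b := ⟨hy.1.1.le, hy.1.2.le.trans hx.2⟩
      obtain ⟨i, hi, hyi⟩ := P.exists_mem_Ioo hyab fun i hi h => hy.2 ⟨i, hi, h.symm⟩
      obtain ⟨p, -, hp⟩ := hv.2.2.2 i hi
      exact (hasDerivAt_of_eq_eval hp hyi).differentiableAt.hasDerivAt)
    (intervalIntegrable_prefix hint hx)
  simp only [Pi.add_apply, this]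
  ring

end IsTrial

/-! ### Consistency -/

lemma hasDerivAt_of_memW (hu : MemW (r + 2) 2 (P.x (i - 1)) (P.x i) u)
    {y : ℝ} (hy : y ∈ Ioo (P.x (i - 1)) (P.x i)) :
    HasDerivAt u (derivWithin u (Icc (P.x (i - 1)) (P.x i)) y) y := by
  have h := hu.hasDerivWithinAt (hy.1.trans hy.2).le (j := 0) (by omega)
    (Ioo_subset_Icc_self hy)
  simp only [iteratedDerivWithin_zero, zero_add, iteratedDerivWithin_one] at h
  exact h.hasDerivAt (Icc_mem_nhds hy.1 hy.2)

lemma IsInterpolant.eval_lobatto (hr : 1 ≤ r) (huI : P.IsInterpolant r u uI)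
    (hi : i ∈ Finset.Icc 1 P.N) {p : ℝ[X]}
    (hp : ∀ y ∈ Icc (P.x (i - 1)) (P.x i), uI y = p.eval y) (hj : j ≤ r) :
    p.eval ((P.x i + P.x (i - 1) + (P.x i - P.x (i - 1)) * lobattoRef r j) / 2) =
      u ((P.x i + P.x (i - 1) + (P.x i - P.x (i - 1)) * lobattoRef r j) / 2) := by
  rw [← hp _ (affine_mem_Icc (P.x_pred_lt hi).le (lobattoRef_mem hr hj))]
  exact huI.2 i hi j hj

variable {α₀ κ Λ : ℝ} {α β γ : ℝ → ℝ}

theorem abs_bilin_sub_interpolant_le (hr : 1 ≤ r) (hα₀ : 0 < α₀) (hκ : 0 < κ)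
    (hC : Coefficients a b α₀ κ Λ α β γ) (hu : MemH10 a b u) (huP : P.MemBroken (r + 2) 2 u)
    (huI : P.IsInterpolant r u uI) (w : ℕ → ℕ → ℝ) :
    |P.bilin r α β γ (fun y => u y - uI y) w| ≤
      Λ * (Real.sqrt r + Real.sqrt (r * (b - a)) * (3 + 5 * (b - a))) * P.h ^ (r + 1) *
        (P.brokenSemi (r + 2) 2 u + P.brokenSemi (r + 1) ⊤ u) * P.jumpNorm r w := by
  have hab := P.lt
  have hΛ := hC.upper_pos hab hα₀
  have hIac := huI.1.absolutelyContinuousOnInterval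
  have heac : AbsolutelyContinuousOnInterval (fun y => u y - uI y) a b :=
    hu.1.absolutelyContinuousOnInterval.fun_sub hIac
  set E := P.brokenSemi (r + 1) ⊤ u * P.h ^ (r + 1) with hEdef
  have hE0 : 0 ≤ E := mul_nonneg (P.brokenSemi_top_nonneg _ _) (pow_nonneg P.h_pos.le _)
  have hE : ∀ x ∈ Icc a b, |u x - uI x| ≤ E := by
    intro x hx
    obtain ⟨i, hi, hxi⟩ := P.exists_mem_Icc hx
    obtain ⟨p, hpd, hp⟩ := huI.1.2.2.2 i hi
    rw [hp x hxi]
    refine (abs_sub_interpolant_le hr (P.x_pred_lt hi) (huP.2 i hi) hpd 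
      (fun j hj => huI.eval_lobatto hr hi hp hj) hxi).trans ?_
    exact mul_le_mul (P.semi_le_brokenSemi_top _ _ hi)
      (pow_le_pow_left₀ (P.len_pos hi).le (P.len_le_h hi) _)
      (pow_nonneg (P.len_pos hi).le _) (P.brokenSemi_top_nonneg _ _)
  set s : ℕ → ℝ := fun i => semi (r + 2) 2 (P.x (i - 1)) (P.x i) u with hs
  have hD : ∀ i ∈ Finset.Icc 1 P.N, ∀ j ∈ Finset.Icc 1 r,
      |deriv (fun y => u y - uI y) (P.gauss r i j)| ≤
        Real.sqrt (P.len i) * s i * P.len i ^ r := by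
    intro i hi j hj
    obtain ⟨p, hpd, hp⟩ := huI.1.2.2.2 i hi
    have hg := P.gauss_mem_Ioo hi hj
    rw [((hasDerivAt_of_memW (huP.2 i hi) hg).fun_sub (hasDerivAt_of_eq_eval hp hg)).deriv,
      P.gauss_eq hj]
    refine abs_deriv_sub_interpolant_gauss_le hr (P.x_pred_lt hi) (huP.2 i hi) hpd
      (fun j hj => huI.eval_lobatto hr hi hp hj) hj
  rw [P.bilin_eq hr w (hC.intervalIntegrable_lower hab heac)]
  have hterm : ∀ i ∈ Finset.Icc 1 P.N, ∀ j ∈ Finset.Icc 1 r,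
      |P.jump r w i j * (α (P.gauss r i j) * deriv (fun y => u y - uI y) (P.gauss r i j) -
        ∫ y in a..(P.gauss r i j), (β y * deriv (fun y => u y - uI y) y + γ y * (u y - uI y)))| ≤
      Λ * (|P.jump r w i j| * (Real.sqrt (P.len i) * s i * P.len i ^ r)) +
        Λ * (3 + 5 * (b - a)) * E * |P.jump r w i j| := by
    intro i hi j hj
    have h1 := hC.abs_integral_lower_le hab hα₀ hκ heac
      (by rw [hu.2.1, huI.1.2.1, sub_zero]) hE (P.gauss_mem hi hj)
    have h2 : |α (P.gauss r i j) * deriv (fun y => u y - uI y) (P.gauss r i j)| ≤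
        Λ * (Real.sqrt (P.len i) * s i * P.len i ^ r) := by
      rw [abs_mul]
      exact mul_le_mul (hC.abs_α_le hα₀ (P.Ioo_subset hi (P.gauss_mem_Ioo hi hj)))
        (hD i hi j hj) (abs_nonneg _) hΛ.le
    rw [abs_mul]
    refine (mul_le_mul_of_nonneg_left ((abs_sub _ _).trans (add_le_add h2 h1))
      (abs_nonneg _)).trans (le_of_eq ?_)
    ring
  have hsum1 : ∑ i ∈ Finset.Icc 1 P.N, ∑ j ∈ Finset.Icc 1 r,
      |P.jump r w i j| * (Real.sqrt (P.len i) * s i * P.len i ^ r) ≤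
      P.jumpNorm r w * (Real.sqrt r * (P.h ^ (r + 1) * P.brokenSemi (r + 2) 2 u)) := by
    refine (P.sum_abs_jump_mul_le w fun i => Real.sqrt (P.len i) * s i * P.len i ^ r).trans ?_
    refine mul_le_mul_of_nonneg_left ?_ (Real.sqrt_nonneg _)
    rw [Real.sqrt_mul (Nat.cast_nonneg _)]
    refine mul_le_mul_of_nonneg_left ?_ (Real.sqrt_nonneg _)
    rw [P.brokenSemi_two, ← Real.sqrt_sq (pow_nonneg P.h_pos.le (r + 1)),
      ← Real.sqrt_mul (sq_nonneg _), Finset.mul_sum]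
    refine Real.sqrt_le_sqrt (Finset.sum_le_sum fun i hi => ?_)
    have hl := P.len_pos hi
    -- The half power from Cauchy–Schwarz over the element and the half power from the jump weight
    -- combine to the full order `r + 1`.
    have he : P.len i * (Real.sqrt (P.len i) * s i * P.len i ^ r) ^ 2 =
        (P.len i ^ (r + 1)) ^ 2 * s i ^ 2 := by
      rw [mul_pow, mul_pow, Real.sq_sqrt hl.le]; ring
    rw [he]
    refine mul_le_mul_of_nonneg_right ?_ (sq_nonneg _)
    exact pow_le_pow_left₀ (pow_nonneg hl.le _) (pow_le_pow_left₀ hl.le (P.len_le_h hi) _) _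
  calc _ ≤ ∑ i ∈ Finset.Icc 1 P.N, ∑ j ∈ Finset.Icc 1 r,
        (Λ * (|P.jump r w i j| * (Real.sqrt (P.len i) * s i * P.len i ^ r)) +
          Λ * (3 + 5 * (b - a)) * E * |P.jump r w i j|) :=
        (Finset.abs_sum_le_sum_abs _ _).trans (Finset.sum_le_sum fun i hi =>
          (Finset.abs_sum_le_sum_abs _ _).trans (Finset.sum_le_sum fun j hj => hterm i hi j hj))
    _ = Λ * (∑ i ∈ Finset.Icc 1 P.N, ∑ j ∈ Finset.Icc 1 r,
          |P.jump r w i j| * (Real.sqrt (P.len i) * s i * P.len i ^ r)) +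
        Λ * (3 + 5 * (b - a)) * E * ∑ i ∈ Finset.Icc 1 P.N, ∑ j ∈ Finset.Icc 1 r,
          |P.jump r w i j| := by
        simp only [Finset.sum_add_distrib, Finset.mul_sum]
    _ ≤ Λ * (P.jumpNorm r w * (Real.sqrt r * (P.h ^ (r + 1) * P.brokenSemi (r + 2) 2 u))) +
        Λ * (3 + 5 * (b - a)) * E * (P.jumpNorm r w * Real.sqrt (r * (b - a))) := by
        refine add_le_add (mul_le_mul_of_nonneg_left hsum1 hΛ.le)
          (mul_le_mul_of_nonneg_left (P.sum_abs_jump_le w) ?_)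
        have : 0 < b - a := sub_pos.mpr hab
        positivity
    _ ≤ _ := by
        have h1 : 0 ≤ P.brokenSemi (r + 2) 2 u := by
          rw [P.brokenSemi_two]; exact Real.sqrt_nonneg _
        have h2 := P.brokenSemi_top_nonneg (r + 1) u
        have h3 : 0 ≤ P.jumpNorm r w := Real.sqrt_nonneg _
        have h4 := P.h_pos
        have h5 : 0 < b - a := sub_pos.mpr hab
        -- These are the cross terms added when both constants are put in front of the sum of the
        -- two seminorms.
        have h6 : 0 ≤ Λ * P.jumpNorm r w * P.h ^ (r + 1) * (Real.sqrt r *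
            P.brokenSemi (r + 1) ⊤ u + Real.sqrt (r * (b - a)) * (3 + 5 * (b - a)) *
            P.brokenSemi (r + 2) 2 u) := by positivity
        rw [hEdef]
        linarith

end Mesh

end FVM

namespace FVM

open Polynomial Set

/-! ### Gauss quadrature on an element -/

section Quadrature

variable {r : ℕ} {c d : ℝ}

lemma sum_gaussWeight_element (hr : 1 ≤ r) (hcd : c < d) {p : ℝ[X]}
    (hp : p.natDegree ≤ 2 * r - 1) :
    ∑ j ∈ Finset.Icc 1 r, (d - c) / 2 * gaussWeight r j *
      p.eval ((d + c + (d - c) * gaussRef r j) / 2) = ∫ x in c..d, p.eval x := by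
  have hl : (d - c) / 2 ≠ 0 := (half_pos (sub_pos.mpr hcd)).ne'
  set q : ℝ[X] := p.comp (C ((d - c) / 2) * X + C ((d + c) / 2)) with hq
  have hqe : ∀ t, q.eval t = p.eval ((d - c) / 2 * t + (d + c) / 2) := fun t => by
    simp [hq]
  have hqd : q.natDegree ≤ 2 * r - 1 := by
    rw [hq, natDegree_comp, natDegree_linear hl, mul_one]; exact hp
  have h1 := sum_gaussWeight r hr q hqd
  simp only [hqe] at h1
  rw [intervalIntegral.integral_comp_mul_add (fun x => p.eval x) hl, smul_eq_mul,
    eq_inv_mul_iff_mul_eq₀ hl, Finset.mul_sum] at h1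
  convert h1 using 2 with j
  · rw [mul_assoc]; congr 3; ring
  · ring
  · ring

/-- The error of Gauss quadrature for the product of a polynomial and a function of small
oscillation. -/
lemma abs_gauss_quadrature_error_le (hr : 1 ≤ r) (hcd : c < d) {q : ℝ[X]}
    (hq : q.natDegree ≤ r - 1) {Φ : ℝ → ℝ} (hΦ : ContinuousOn Φ (Icc c d)) {B : ℝ}
    (hB : ∀ x ∈ Icc c d, |Φ x - Φ c| ≤ B) :
    |∑ j ∈ Finset.Icc 1 r, (d - c) / 2 * gaussWeight r j *
        q.eval ((d + c + (d - c) * gaussRef r j) / 2) *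
        Φ ((d + c + (d - c) * gaussRef r j) / 2) - ∫ x in c..d, q.eval x * Φ x| ≤
      2 * Real.sqrt (d - c) * Real.sqrt (∫ x in c..d, q.eval x ^ 2) * B := by
  set g : ℕ → ℝ := fun j => (d + c + (d - c) * gaussRef r j) / 2 with hg
  set m : ℕ → ℝ := fun j => (d - c) / 2 * gaussWeight r j with hm
  have hm0 : ∀ j ∈ Finset.Icc 1 r, 0 ≤ m j := fun j hj =>
    mul_nonneg (half_pos (sub_pos.mpr hcd)).le (gaussWeight_nonneg hj)
  have hB0 : 0 ≤ B := (abs_nonneg _).trans (hB c (left_mem_Icc.mpr hcd.le))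
  have hΦ' : ContinuousOn Φ (uIcc c d) := by rwa [uIcc_of_le hcd.le]
  have hqi : IntervalIntegrable (fun x => q.eval x) volume c d :=
    q.continuous.intervalIntegrable _ _
  have hq2 : IntervalIntegrable (fun x => q.eval x ^ 2) volume c d :=
    (q.continuous.pow 2).intervalIntegrable _ _
  have hexact : ∑ j ∈ Finset.Icc 1 r, m j * q.eval (g j) = ∫ x in c..d, q.eval x :=
    sum_gaussWeight_element hr hcd (by omega)
  have hexact2 : ∑ j ∈ Finset.Icc 1 r, m j * q.eval (g j) ^ 2 = ∫ x in c..d, q.eval x ^ 2 := by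
    have := sum_gaussWeight_element hr hcd (p := q ^ 2) (natDegree_pow_le.trans (by omega))
    simpa only [eval_pow] using this
  have hmsum : ∑ j ∈ Finset.Icc 1 r, m j = d - c := by
    rw [hm, ← Finset.mul_sum, sum_gaussWeight_eq_two hr]; ring
  have hdisc : ∑ j ∈ Finset.Icc 1 r, m j * |q.eval (g j)| ≤
      Real.sqrt (d - c) * Real.sqrt (∫ x in c..d, q.eval x ^ 2) := by
    rw [← hmsum, ← hexact2]
    refine le_trans (le_of_eq ?_) ((Real.sum_mul_le_sqrt_mul_sqrt (Finset.Icc 1 r)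
      (fun j => Real.sqrt (m j)) (fun j => Real.sqrt (m j) * |q.eval (g j)|)).trans (le_of_eq ?_))
    · refine Finset.sum_congr rfl fun j hj => ?_
      rw [← mul_assoc, Real.mul_self_sqrt (hm0 j hj)]
    · congr 2
      · exact Finset.sum_congr rfl fun j hj => Real.sq_sqrt (hm0 j hj)
      · refine Finset.sum_congr rfl fun j hj => ?_
        rw [mul_pow, Real.sq_sqrt (hm0 j hj), sq_abs]
  -- Exactness for `q` permits subtracting the constant `Φ c`, so only the oscillation of `Φ`
  -- enters.
  have hsplit : ∑ j ∈ Finset.Icc 1 r, m j * q.eval (g j) * Φ (g j) -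
      ∫ x in c..d, q.eval x * Φ x =
      ∑ j ∈ Finset.Icc 1 r, m j * q.eval (g j) * (Φ (g j) - Φ c) -
        ∫ x in c..d, q.eval x * (Φ x - Φ c) := by
    have h1 : ∫ x in c..d, q.eval x * (Φ x - Φ c) =
        (∫ x in c..d, q.eval x * Φ x) - (∫ x in c..d, q.eval x) * Φ c := by
      simp only [mul_sub]
      rw [intervalIntegral.integral_sub (hqi.mul_continuousOn hΦ') (hqi.mul_const _),
        intervalIntegral.integral_mul_const]
    rw [h1, ← hexact]
    simp only [mul_sub, Finset.sum_sub_distrib, Finset.sum_mul]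
    ring
  have h1 : |∑ j ∈ Finset.Icc 1 r, m j * q.eval (g j) * (Φ (g j) - Φ c)| ≤
      Real.sqrt (d - c) * Real.sqrt (∫ x in c..d, q.eval x ^ 2) * B := by
    refine le_trans ?_ (mul_le_mul_of_nonneg_right hdisc hB0)
    rw [Finset.sum_mul]
    refine (Finset.abs_sum_le_sum_abs _ _).trans (Finset.sum_le_sum fun j hj => ?_)
    rw [abs_mul, abs_mul, abs_of_nonneg (hm0 j hj)]
    exact mul_le_mul_of_nonneg_left
      (hB _ (affine_mem_Icc hcd.le (Ioo_subset_Icc_self (gaussRef_mem hj))))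
      (mul_nonneg (hm0 j hj) (abs_nonneg _))
  have h2 : |∫ x in c..d, q.eval x * (Φ x - Φ c)| ≤
      Real.sqrt (d - c) * Real.sqrt (∫ x in c..d, q.eval x ^ 2) * B := by
    refine le_trans ?_ (mul_le_mul_of_nonneg_right (integral_abs_le_sqrt hcd.le hqi hq2) hB0)
    refine (intervalIntegral.abs_integral_le_integral_abs hcd.le).trans ?_
    rw [← intervalIntegral.integral_mul_const]
    refine intervalIntegral.integral_mono_on hcd.le
      (hqi.mul_continuousOn (hΦ'.sub continuousOn_const)).abs (hqi.abs.mul_const _) fun x hx => ?_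
    rw [abs_mul]
    exact mul_le_mul_of_nonneg_left (hB x hx) (abs_nonneg _)
  rw [hsplit]
  refine (abs_sub _ _).trans ((add_le_add h1 h2).trans (le_of_eq ?_))
  ring

end Quadrature

/-! ### The energy of the lower order terms -/

lemma integral_mul_integral_eq {v F : ℝ → ℝ} {a b : ℝ}
    (hv : AbsolutelyContinuousOnInterval v a b)
    (hva : v a = 0) (hvb : v b = 0) (hF : IntervalIntegrable F volume a b) :
    ∫ x in a..b, deriv v x * ∫ y in a..x, F y = -∫ x in a..b, v x * F x := by
  have hΦ := hF.absolutelyContinuousOnInterval_intervalIntegral (c := a) left_mem_uIcc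
  have h := hΦ.integral_mul_deriv_eq_deriv_mul hv
  simp only [hva, hvb, mul_zero, sub_zero, zero_sub] at h
  simp only [mul_comm (deriv v _)]
  rw [h, neg_inj]
  refine intervalIntegral.integral_congr_ae ?_
  filter_upwards [hF.ae_hasDerivAt_integral] with x hx hxab
  rw [(hx (uIoc_subset_uIcc hxab) a left_mem_uIcc).deriv, mul_comm]

namespace Coefficients

variable {a b α₀ κ Λ : ℝ} {α β γ v : ℝ → ℝ}

/-- Subtracting half of `(β v²)'`, whose integral vanishes with `v` at the ends, leaves the
integrand `(γ - β'/2) v²`. -/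
lemma le_integral_mul_lower (hC : Coefficients a b α₀ κ Λ α β γ) (hab : a < b)
    (hv : AbsolutelyContinuousOnInterval v a b) (hva : v a = 0) (hvb : v b = 0) :
    κ * ∫ x in a..b, v x ^ 2 ≤ ∫ x in a..b, v x * (β x * deriv v x + γ x * v x) := by
  have hv2 := hv.fun_mul hv
  have h0 := hC.β_ac.integral_deriv_mul_eq_sub hv2
  simp only [hva, hvb, mul_zero, sub_zero] at h0
  have hI1 : IntervalIntegrable (fun x => deriv β x * (v x * v x) +
      β x * deriv (fun y => v y * v y) x) volume a b :=
    (hC.β_ac.intervalIntegrable_deriv.mul_continuousOn hv2.continuousOn).add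
      (hC.intervalIntegrable_β_mul_deriv hv2)
  have hI2 : IntervalIntegrable (fun x => v x * (β x * deriv v x + γ x * v x)) volume a b :=
    (hC.intervalIntegrable_lower hab hv).continuousOn_mul hv.continuousOn
  have hI3 : IntervalIntegrable (fun x => v x ^ 2) volume a b :=
    (hv.continuousOn.pow 2).intervalIntegrable
  have h1 : ∫ x in a..b, v x * (β x * deriv v x + γ x * v x) =
      ∫ x in a..b, (v x * (β x * deriv v x + γ x * v x) - 1 / 2 *
        (deriv β x * (v x * v x) + β x * deriv (fun y => v y * v y) x)) := by
    rw [intervalIntegral.integral_sub hI2 (hI1.const_mul _),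
      intervalIntegral.integral_const_mul, h0]
    ring
  rw [h1, ← intervalIntegral.integral_const_mul]
  refine intervalIntegral.integral_mono_ae_restrict hab.le (hI3.const_mul _)
    (hI2.sub (hI1.const_mul _)) ?_
  filter_upwards [hC.coercive, ae_restrict_mem measurableSet_Icc,
    ae_restrict_of_ae hv.ae_differentiableAt] with x hx hxab hd
  have hd' := hd (Icc_subset_uIcc hxab)
  rw [deriv_fun_mul hd' hd']
  have := mul_le_mul_of_nonneg_right hx (sq_nonneg (v x))
  linarith

lemma integral_abs_lower_le (hC : Coefficients a b α₀ κ Λ α β γ) (hab : a < b) (hα₀ : 0 < α₀)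
    (hv : AbsolutelyContinuousOnInterval v a b)
    (hv2 : IntervalIntegrable (fun x => deriv v x ^ 2) volume a b) :
    ∫ x in a..b, |β x * deriv v x + γ x * v x| ≤ Λ * Real.sqrt (b - a) *
      (Real.sqrt (∫ x in a..b, deriv v x ^ 2) + Real.sqrt (∫ x in a..b, v x ^ 2)) := by
  have hΛ := hC.upper_pos hab hα₀
  have hd := hv.intervalIntegrable_deriv
  have hi : IntervalIntegrable v volume a b := hv.continuousOn.intervalIntegrable
  have h1 := integral_abs_le_sqrt hab.le hd hv2
  have h2 := integral_abs_le_sqrt hab.le hi (hv.continuousOn.pow 2).intervalIntegrable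
  have h3 : ∫ x in a..b, |β x * deriv v x + γ x * v x| ≤
      ∫ x in a..b, (Λ * |deriv v x| + Λ * |v x|) := by
    refine intervalIntegral.integral_mono_ae_restrict hab.le
      (hC.intervalIntegrable_lower hab hv).abs
      ((hd.abs.const_mul _).add (hi.abs.const_mul _)) ?_
    filter_upwards [hC.γ_bound, ae_restrict_mem measurableSet_Icc] with x hx hxab
    refine (abs_add_le _ _).trans ?_
    rw [abs_mul, abs_mul]
    exact add_le_add (mul_le_mul_of_nonneg_right (hC.abs_β_le hab hxab) (abs_nonneg _))
      (mul_le_mul_of_nonneg_right hx (abs_nonneg _))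
  rw [intervalIntegral.integral_add (hd.abs.const_mul _) (hi.abs.const_mul _),
    intervalIntegral.integral_const_mul, intervalIntegral.integral_const_mul] at h3
  have h4 := mul_le_mul_of_nonneg_left (add_le_add h1 h2) hΛ.le
  linarith

end Coefficients

namespace Mesh

variable {a b : ℝ} (P : Mesh a b) {r i j : ℕ} {u v uI : ℝ → ℝ}

/-! ### The test function of a trial function -/

/-- The coefficients of the test function whose jump at a Gauss point is `v'` times the weight
of this point. -/
noncomputable def gaussTest (r : ℕ) (v : ℝ → ℝ) (i j : ℕ) : ℝ :=
  v (P.x (i - 1)) + ∑ k ∈ Finset.Icc 1 j,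
    P.len i / 2 * gaussWeight r k * deriv v (P.gauss r i k)

variable {P}

namespace IsTrial

lemma exists_deriv_eq_eval (hv : P.IsTrial r v) (hi : i ∈ Finset.Icc 1 P.N) : ∃ q : ℝ[X], q.natDegree ≤ r - 1 ∧
    ∀ y ∈ Ioo (P.x (i - 1)) (P.x i), deriv v y = q.eval y := by
  obtain ⟨p, hpd, hp⟩ := hv.2.2.2 i hi
  refine ⟨derivative p, ?_, fun y hy => (hasDerivAt_of_eq_eval hp hy).deriv⟩
  rw [natDegree_derivative]; omega

/-- Gauss quadrature is exact for `v'` on the element, so the accumulated jumps give `v(x_i) -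
v(x_{i-1})`. Hence the values on neighbouring elements fit together, and the zero conventions at
both ends follow from `v(a) = v(b) = 0`. -/
lemma gaussTest_last (hv : P.IsTrial r v) (hr : 1 ≤ r) (hi : i ∈ Finset.Icc 1 P.N) :
    P.gaussTest r v i r = v (P.x i) := by
  have hlt := P.x_pred_lt hi
  obtain ⟨q, hqd, hq⟩ := hv.exists_deriv_eq_eval hi
  have h1 := (hv.absolutelyContinuousOnInterval.mono (c := P.x (i - 1)) (d := P.x i) (by
    rw [uIcc_of_le hlt.le, uIcc_of_le P.lt.le]; exact P.Icc_subset hi)).integral_deriv_eq_sub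
  rw [intervalIntegral.integral_congr_Ioo_of_le hlt.le hq,
    ← sum_gaussWeight_element hr hlt (by omega)] at h1
  rw [gaussTest, ← eq_sub_iff_add_eq', ← h1]
  refine Finset.sum_congr rfl fun j hj => ?_
  rw [hq _ (P.gauss_mem_Ioo hi hj), P.gauss_eq hj, len]

lemma ext_gaussTest (hv : P.IsTrial r v) (hr : 1 ≤ r) (hi : i ∈ Finset.Icc 1 P.N) (j : ℕ) :
    P.ext r (P.gaussTest r v) i j = P.gaussTest r v i j := by
  have hi' := Finset.mem_Icc.mp hi
  rw [ext]
  split_ifs with hj h1 hN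
  · subst hj h1
    simp [gaussTest, P.x_zero, hv.2.1]
  · subst hj
    rw [hv.gaussTest_last hr (Finset.mem_Icc.mpr (by omega))]
    simp [gaussTest]
  · rw [hN.2, hv.gaussTest_last hr hi, hN.1, P.x_N, hv.2.2.1]
  · rfl

lemma jump_gaussTest (hv : P.IsTrial r v) (hi : i ∈ Finset.Icc 1 P.N) (hj : j ∈ Finset.Icc 1 r) :
    P.jump r (P.gaussTest r v) i j =
      P.len i / 2 * gaussWeight r j * deriv v (P.gauss r i j) := by
  rw [Finset.mem_Icc] at hj
  obtain ⟨k, rfl⟩ : ∃ k, j = k + 1 := ⟨j - 1, by omega⟩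
  rw [jump, hv.ext_gaussTest (by omega) hi, hv.ext_gaussTest (by omega) hi, Nat.add_sub_cancel,
    gaussTest, gaussTest, Finset.sum_Icc_succ_top (by omega)]
  ring

lemma sum_deriv_sq (hv : P.IsTrial r v) (hr : 1 ≤ r) :
    ∑ i ∈ Finset.Icc 1 P.N, ∑ j ∈ Finset.Icc 1 r,
      P.len i / 2 * gaussWeight r j * deriv v (P.gauss r i j) ^ 2 =
      ∫ x in a..b, deriv v x ^ 2 := by
  rw [← P.sum_integral (hv.intervalIntegrable_comp_deriv (continuous_pow 2))]
  refine Finset.sum_congr rfl fun i hi => ?_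
  have hlt := P.x_pred_lt hi
  obtain ⟨q, hqd, hq⟩ := hv.exists_deriv_eq_eval hi
  rw [intervalIntegral.integral_congr_Ioo_of_le (g := fun x => (q ^ 2).eval x) hlt.le
    (fun y hy => by simp only [hq y hy, eval_pow]),
    ← sum_gaussWeight_element hr hlt (natDegree_pow_le.trans (by omega))]
  refine Finset.sum_congr rfl fun j hj => ?_
  rw [hq _ (P.gauss_mem_Ioo hi hj), P.gauss_eq hj, len, eval_pow]

lemma jumpNorm_gaussTest_le (hv : P.IsTrial r v) (hr : 1 ≤ r) :
    P.jumpNorm r (P.gaussTest r v) ≤ Real.sqrt (∫ x in a..b, deriv v x ^ 2) := by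
  rw [← hv.sum_deriv_sq hr]
  refine Real.sqrt_le_sqrt (Finset.sum_le_sum fun i hi => Finset.sum_le_sum fun j hj => ?_)
  have hl := P.len_pos hi
  rw [hv.jump_gaussTest hi hj]
  -- One summand of the quadrature for `∫ v'²`, times half the weight, which is at most one.
  have h1 : (P.len i)⁻¹ * (P.len i / 2 * gaussWeight r j * deriv v (P.gauss r i j)) ^ 2 =
      P.len i / 2 * gaussWeight r j * deriv v (P.gauss r i j) ^ 2 * (gaussWeight r j / 2) := by
    field_simp
  rw [h1]
  refine mul_le_of_le_one_right ?_ (by linarith [gaussWeight_le_two hj])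
  exact mul_nonneg (mul_nonneg (by positivity) (gaussWeight_nonneg hj)) (sq_nonneg _)

/-- On an element the primitive of `F` oscillates by at most the local integral of `|F|`. These add
up over the mesh, while the local `L²` norm of `v'` is bounded by the global one; hence the half
power of `h`. -/
lemma abs_sum_gauss_sub_integral_le (hv : P.IsTrial r v) (hr : 1 ≤ r) {F : ℝ → ℝ}
    (hF : IntervalIntegrable F volume a b) :
    |∑ i ∈ Finset.Icc 1 P.N, ∑ j ∈ Finset.Icc 1 r, P.len i / 2 * gaussWeight r j *
        deriv v (P.gauss r i j) * (∫ y in a..(P.gauss r i j), F y) -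
      ∫ x in a..b, deriv v x * ∫ y in a..x, F y| ≤
      2 * Real.sqrt P.h * Real.sqrt (∫ x in a..b, deriv v x ^ 2) * ∫ x in a..b, |F x| := by
  have hΦ : ContinuousOn (fun x => ∫ y in a..x, F y) (Icc a b) := by
    have := (hF.absolutelyContinuousOnInterval_intervalIntegral (c := a)
      left_mem_uIcc).continuousOn
    rwa [uIcc_of_le P.lt.le] at this
  have hv1 : IntervalIntegrable (deriv v) volume a b :=
    hv.intervalIntegrable_comp_deriv continuous_id
  have hv2 := hv.intervalIntegrable_comp_deriv (continuous_pow 2)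
  rw [← P.sum_integral (hv1.mul_continuousOn (by rwa [uIcc_of_le P.lt.le])),
    ← P.sum_integral hF.abs, ← Finset.sum_sub_distrib, Finset.mul_sum]
  refine (Finset.abs_sum_le_sum_abs _ _).trans (Finset.sum_le_sum fun i hi => ?_)
  have hlt := P.x_pred_lt hi
  obtain ⟨q, hqd, hq⟩ := hv.exists_deriv_eq_eval hi
  have hFi := P.intervalIntegrable_element hF hi
  have hB : ∀ x ∈ Icc (P.x (i - 1)) (P.x i), |(∫ y in a..x, F y) - ∫ y in a..(P.x (i - 1)), F y| ≤
      ∫ y in (P.x (i - 1))..(P.x i), |F y| := by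
    intro x hx
    rw [intervalIntegral.integral_interval_sub_left
      (intervalIntegrable_prefix hF (P.Icc_subset hi hx))
      (intervalIntegrable_prefix hF (P.x_pred_mem hi))]
    exact (intervalIntegral.abs_integral_le_integral_abs hx.1).trans
      (intervalIntegral.integral_mono_interval le_rfl hx.1 hx.2
        (Filter.Eventually.of_forall fun t => abs_nonneg _) hFi.abs)
  have h := abs_gauss_quadrature_error_le hr hlt hqd (hΦ.mono (P.Icc_subset hi)) hB
  rw [← intervalIntegral.integral_congr_Ioo_of_le (f := fun x => deriv v x * ∫ y in a..x, F y)
    (g := fun x => q.eval x * ∫ y in a..x, F y) hlt.le (fun y hy => by simp only [hq y hy]),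
    ← intervalIntegral.integral_congr_Ioo_of_le (f := fun x => deriv v x ^ 2)
    (g := fun x => q.eval x ^ 2) hlt.le (fun y hy => by simp only [hq y hy])] at h
  have hsum : ∑ j ∈ Finset.Icc 1 r, P.len i / 2 * gaussWeight r j *
        deriv v (P.gauss r i j) * (∫ y in a..(P.gauss r i j), F y) =
      ∑ j ∈ Finset.Icc 1 r, (P.x i - P.x (i - 1)) / 2 * gaussWeight r j *
        q.eval ((P.x i + P.x (i - 1) + (P.x i - P.x (i - 1)) * gaussRef r j) / 2) *
        ∫ y in a..((P.x i + P.x (i - 1) + (P.x i - P.x (i - 1)) * gaussRef r j) / 2), F y := by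
    refine Finset.sum_congr rfl fun j hj => ?_
    rw [hq _ (P.gauss_mem_Ioo hi hj), P.gauss_eq hj, len]
  rw [hsum]
  refine h.trans (mul_le_mul_of_nonneg_right ?_
    (intervalIntegral.integral_nonneg hlt.le fun x _ => abs_nonneg _))
  refine mul_le_mul ?_ (Real.sqrt_le_sqrt ?_) (Real.sqrt_nonneg _) (by positivity)
  · exact mul_le_mul_of_nonneg_left (Real.sqrt_le_sqrt (P.len_le_h hi)) (by norm_num)
  · exact intervalIntegral.integral_mono_interval (P.x_pred_mem hi).1 hlt.le (P.x_mem' hi).2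
      (Filter.Eventually.of_forall fun t => sq_nonneg _) hv2

/-! ### Stability -/

theorem le_bilin_gaussTest (hv : P.IsTrial r v) (hr : 1 ≤ r) {α₀ κ Λ : ℝ} (hα₀ : 0 < α₀) {α β γ : ℝ → ℝ}
    (hC : Coefficients a b α₀ κ Λ α β γ) :
    α₀ * (∫ x in a..b, deriv v x ^ 2) + κ * (∫ x in a..b, v x ^ 2) -
        4 * Real.sqrt P.h * (Λ * Real.sqrt (b - a)) *
          ((∫ x in a..b, deriv v x ^ 2) + ∫ x in a..b, v x ^ 2) ≤
      P.bilin r α β γ v (P.gaussTest r v) := by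
  have hab := P.lt
  have hΛ := hC.upper_pos hab hα₀
  have hac := hv.absolutelyContinuousOnInterval
  have hF := hC.intervalIntegrable_lower hab hac
  set D := ∫ x in a..b, deriv v x ^ 2 with hD
  set E := ∫ x in a..b, v x ^ 2 with hE
  have hD0 : 0 ≤ D := intervalIntegral.integral_nonneg hab.le fun x _ => sq_nonneg _
  have hE0 : 0 ≤ E := intervalIntegral.integral_nonneg hab.le fun x _ => sq_nonneg _
  have h1 := hv.abs_sum_gauss_sub_integral_le hr hF
  rw [integral_mul_integral_eq hac hv.2.1 hv.2.2.1 hF, ← hD] at h1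
  have h2 := hC.le_integral_mul_lower hab hac hv.2.1 hv.2.2.1
  have h3 := hC.integral_abs_lower_le hab hα₀ hac
    (hv.intervalIntegrable_comp_deriv (continuous_pow 2))
  rw [← hD, ← hE] at h3
  have h4 : α₀ * D ≤ ∑ i ∈ Finset.Icc 1 P.N, ∑ j ∈ Finset.Icc 1 r,
      P.len i / 2 * gaussWeight r j * deriv v (P.gauss r i j) *
        (α (P.gauss r i j) * deriv v (P.gauss r i j)) := by
    rw [hD, ← hv.sum_deriv_sq hr, Finset.mul_sum]
    refine Finset.sum_le_sum fun i hi => ?_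
    rw [Finset.mul_sum]
    refine Finset.sum_le_sum fun j hj => ?_
    have hl := P.len_pos hi
    have hα := hC.α_lower _ (P.Ioo_subset hi (P.gauss_mem_Ioo hi hj))
    have h0 : 0 ≤ P.len i / 2 * gaussWeight r j * deriv v (P.gauss r i j) ^ 2 :=
      mul_nonneg (mul_nonneg (by positivity) (gaussWeight_nonneg hj)) (sq_nonneg _)
    have := mul_le_mul_of_nonneg_right hα h0
    linarith
  have h5 : P.bilin r α β γ v (P.gaussTest r v) =
      (∑ i ∈ Finset.Icc 1 P.N, ∑ j ∈ Finset.Icc 1 r,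
        P.len i / 2 * gaussWeight r j * deriv v (P.gauss r i j) *
          (α (P.gauss r i j) * deriv v (P.gauss r i j))) -
      ∑ i ∈ Finset.Icc 1 P.N, ∑ j ∈ Finset.Icc 1 r, P.len i / 2 * gaussWeight r j *
        deriv v (P.gauss r i j) *
          (∫ y in a..(P.gauss r i j), (β y * deriv v y + γ y * v y)) := by
    rw [P.bilin_eq hr _ hF, ← Finset.sum_sub_distrib]
    refine Finset.sum_congr rfl fun i hi => ?_
    rw [← Finset.sum_sub_distrib]
    refine Finset.sum_congr rfl fun j hj => ?_
    rw [hv.jump_gaussTest hi hj, mul_sub]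
  have h6 : Real.sqrt D * (Real.sqrt D + Real.sqrt E) ≤ 2 * (D + E) := by
    nlinarith [Real.sq_sqrt hD0, Real.sq_sqrt hE0, sq_nonneg (Real.sqrt D - Real.sqrt E)]
  have h7 : 2 * Real.sqrt P.h * Real.sqrt D * (∫ x in a..b, |β x * deriv v x + γ x * v x|) ≤
      4 * Real.sqrt P.h * (Λ * Real.sqrt (b - a)) * (D + E) := by
    calc _ ≤ 2 * Real.sqrt P.h * Real.sqrt D *
          (Λ * Real.sqrt (b - a) * (Real.sqrt D + Real.sqrt E)) :=
          mul_le_mul_of_nonneg_left h3 (by positivity)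
      _ = 2 * Real.sqrt P.h * (Λ * Real.sqrt (b - a)) *
          (Real.sqrt D * (Real.sqrt D + Real.sqrt E)) := by ring
      _ ≤ 2 * Real.sqrt P.h * (Λ * Real.sqrt (b - a)) * (2 * (D + E)) :=
          mul_le_mul_of_nonneg_left h6 (by positivity)
      _ = _ := by ring
  rw [h5]
  linarith [(abs_le.mp h1).2]

lemma sub (hv : P.IsTrial r v) (hu : P.IsTrial r u) : P.IsTrial r (fun y => v y - u y) := by
  refine ⟨hv.1.sub hu.1, by simp [hv.2.1, hu.2.1], by simp [hv.2.2.1, hu.2.2.1], fun i hi => ?_⟩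
  obtain ⟨p, hpd, hp⟩ := hv.2.2.2 i hi
  obtain ⟨q, hqd, hq⟩ := hu.2.2.2 i hi
  exact ⟨p - q, (natDegree_sub_le _ _).trans (max_le hpd hqd), fun y hy => by
    simp only [hp y hy, hq y hy, eval_sub]⟩

lemma normH1_eq (hv : P.IsTrial r v) : normH1 a b v =
    Real.sqrt ((∫ x in a..b, deriv v x ^ 2) + ∫ x in a..b, v x ^ 2) := by
  have hab := P.lt.le
  have hae : derivWithin v (Icc a b) =ᵐ[volume.restrict (Icc a b)] deriv v :=
    (ae_restrict_iff' measurableSet_Icc).mpr (ae_derivWithin_eq_deriv v a b)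
  have h0 : MemLp v 2 (volume.restrict (Icc a b)) := by
    rw [memLp_two_iff_integrable_sq (hv.1.aestronglyMeasurable measurableSet_Icc)]
    exact (hv.1.pow 2).integrableOn_Icc
  have h1 : MemLp (deriv v) 2 (volume.restrict (Icc a b)) := by
    rw [memLp_two_iff_integrable_sq (measurable_deriv v).aestronglyMeasurable]
    exact (intervalIntegrable_iff_integrableOn_Icc_of_le hab).mp
      (hv.intervalIntegrable_comp_deriv (continuous_pow 2))
  rw [normH1, semi, semi, iteratedDerivWithin_one, iteratedDerivWithin_zero,
    eLpNorm_congr_ae hae, toReal_eLpNorm_two_sq hab h0, toReal_eLpNorm_two_sq hab h1, add_comm]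

end IsTrial

/-! ### Linearity and Galerkin orthogonality -/

variable {α₀ κ Λ : ℝ} {α β γ : ℝ → ℝ}

lemma bilin_sub (hr : 1 ≤ r) (hC : Coefficients a b α₀ κ Λ α β γ)
    (hu : AbsolutelyContinuousOnInterval u a b) (hv : AbsolutelyContinuousOnInterval v a b)
    (hud : ∀ i ∈ Finset.Icc 1 P.N, ∀ j ∈ Finset.Icc 1 r, DifferentiableAt ℝ u (P.gauss r i j))
    (hvd : ∀ i ∈ Finset.Icc 1 P.N, ∀ j ∈ Finset.Icc 1 r, DifferentiableAt ℝ v (P.gauss r i j))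
    (w : ℕ → ℕ → ℝ) :
    P.bilin r α β γ (fun y => u y - v y) w =
      P.bilin r α β γ u w - P.bilin r α β γ v w := by
  have hab := P.lt
  have hFu := hC.intervalIntegrable_lower hab hu
  have hFv := hC.intervalIntegrable_lower hab hv
  rw [P.bilin_eq hr w hFu, P.bilin_eq hr w hFv,
    P.bilin_eq hr w (hC.intervalIntegrable_lower hab (hu.fun_sub hv)), ← Finset.sum_sub_distrib]
  refine Finset.sum_congr rfl fun i hi => ?_
  rw [← Finset.sum_sub_distrib]
  refine Finset.sum_congr rfl fun j hj => ?_
  have hg := P.gauss_mem hi hj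
  have hint : ∫ y in a..(P.gauss r i j),
      (β y * deriv (fun y => u y - v y) y + γ y * (u y - v y)) =
      (∫ y in a..(P.gauss r i j), (β y * deriv u y + γ y * u y)) -
        ∫ y in a..(P.gauss r i j), (β y * deriv v y + γ y * v y) := by
    rw [← intervalIntegral.integral_sub (intervalIntegrable_prefix hFu hg)
      (intervalIntegrable_prefix hFv hg)]
    refine intervalIntegral.integral_congr_ae ?_
    filter_upwards [ae_deriv_sub hu hv] with x hx hxg
    have hxab : x ∈ uIcc a b := by
      have := uIoc_subset_uIcc hxg
      rw [uIcc_of_le hg.1] at this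
      rw [uIcc_of_le hab.le]
      exact ⟨this.1, this.2.trans hg.2⟩
    rw [hx hxab]
    ring
  rw [hint, deriv_fun_sub (hud i hi j hj) (hvd i hi j hj)]
  ring

lemma IsTrial.differentiableAt_gauss (hv : P.IsTrial r v) (hi : i ∈ Finset.Icc 1 P.N)
    (hj : j ∈ Finset.Icc 1 r) : DifferentiableAt ℝ v (P.gauss r i j) := by
  obtain ⟨p, -, hp⟩ := hv.2.2.2 i hi
  exact (hasDerivAt_of_eq_eval hp (P.gauss_mem_Ioo hi hj)).differentiableAt

lemma MemBroken.differentiableAt_gauss (hu : P.MemBroken (r + 2) 2 u)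
    (hi : i ∈ Finset.Icc 1 P.N) (hj : j ∈ Finset.Icc 1 r) :
    DifferentiableAt ℝ u (P.gauss r i j) :=
  (hasDerivAt_of_memW (hu.2 i hi) (P.gauss_mem_Ioo hi hj)).differentiableAt

/-- Integrating the equation from `a` to a Gauss point gives `q - q(a)` there. Gauss points are
interior to elements, so `u` is differentiable and `q = α u'`; the constant `q(a)` disappears
because the jumps sum to zero. -/
lemma bilin_eq_of_isSolution (hr : 1 ≤ r) (hC : Coefficients a b α₀ κ Λ α β γ) {f : ℝ → ℝ}
    (hu : P.MemBroken (r + 2) 2 u) (hsol : IsSolution a b α β γ f u) (w : ℕ → ℕ → ℝ) :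
    P.bilin r α β γ u w = ∫ y in a..b, f y * P.testFun r w y := by
  have hab := P.lt
  obtain ⟨hu10, q, hq, hflux, heq⟩ := hsol
  have hF := hC.intervalIntegrable_lower hab hu10.1.absolutelyContinuousOnInterval
  have hq' := hq.intervalIntegrable_deriv
  have hfI : IntervalIntegrable (fun x => (β x * deriv u x + γ x * u x) - deriv q x) volume a b :=
    hF.sub hq'
  have hae : ∀ᵐ x ∂(volume.restrict (uIoc a b)),
      (β x * deriv u x + γ x * u x) - deriv q x = f x := by
    rw [uIoc_of_le hab.le, restrict_Ioc_eq_restrict_Icc]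
    filter_upwards [heq] with x hx
    rw [← hx]; ring
  have hint : ∫ y in a..b, f y * P.testFun r w y =
      ∫ y in a..b, ((β y * deriv u y + γ y * u y) - deriv q y) * P.testFun r w y := by
    refine intervalIntegral.integral_congr_ae_restrict ?_
    filter_upwards [hae] with x hx
    rw [hx]
  have hconst : ∑ i ∈ Finset.Icc 1 P.N, ∑ j ∈ Finset.Icc 1 r, P.jump r w i j * q a = 0 := by
    simpa using P.sum_jump_mul hr w (fun _ => q a)
  rw [hint, P.integral_mul_testFun hr w hfI, P.bilin_eq hr w hF, eq_neg_iff_add_eq_zero,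
    ← hconst, ← Finset.sum_add_distrib]
  refine Finset.sum_congr rfl fun i hi => ?_
  rw [← Finset.sum_add_distrib]
  refine Finset.sum_congr rfl fun j hj => ?_
  have hg := P.gauss_mem hi hj
  have hqg : ∫ y in a..(P.gauss r i j), deriv q y = q (P.gauss r i j) - q a :=
    (hq.mono (by
      rw [uIcc_of_le hg.1, uIcc_of_le hab.le]
      exact Icc_subset_Icc_right hg.2)).integral_deriv_eq_sub
  rw [intervalIntegral.integral_sub (intervalIntegrable_prefix hF hg)
    (intervalIntegrable_prefix hq' hg), hqg, hflux _ (P.Ioo_subset hi (P.gauss_mem_Ioo hi hj))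
    (hu.differentiableAt_gauss hi hj)]
  ring

end Mesh

end FVM

namespace FVM.Mesh

/-! ### The error estimate -/

theorem normH1_interpolant_sub_le {a b : ℝ} {P : Mesh a b} {r : ℕ} {u uI uP f α β γ : ℝ → ℝ}
    {α₀ κ Λ : ℝ} (hr : 1 ≤ r) (hα₀ : 0 < α₀) (hκ : 0 < κ)
    (hC : Coefficients a b α₀ κ Λ α β γ) (huP : P.MemBroken (r + 2) 2 u)
    (huI : P.IsInterpolant r u uI)
    (hh : P.h ≤ (min α₀ κ / (8 * (Λ * Real.sqrt (b - a)))) ^ 2)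
    (hsol : IsSolution a b α β γ f u) (hfvm : P.IsFVMSolution r α β γ f uP) :
    normH1 a b (fun y => uI y - uP y) ≤
      2 / min α₀ κ * (Λ * (Real.sqrt r + Real.sqrt (r * (b - a)) * (3 + 5 * (b - a)))) *
        P.h ^ (r + 1) * (P.brokenSemi (r + 2) 2 u + P.brokenSemi (r + 1) ⊤ u) := by
  have hab := P.lt
  have hΛ := hC.upper_pos hab hα₀
  have hv := huI.1.sub hfvm.1
  set v : ℝ → ℝ := fun y => uI y - uP y with hvdef
  set w := P.gaussTest r v
  set m := min α₀ κ with hm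
  have hm0 : 0 < m := lt_min hα₀ hκ
  set M := Λ * Real.sqrt (b - a) with hM
  have hM0 : 0 < M := mul_pos hΛ (Real.sqrt_pos.mpr (sub_pos.mpr hab))
  set C₀ := Λ * (Real.sqrt r + Real.sqrt (r * (b - a)) * (3 + 5 * (b - a))) with hC₀
  have hC₀0 : 0 ≤ C₀ := by
    have : 0 < b - a := sub_pos.mpr hab
    positivity
  set K := P.brokenSemi (r + 2) 2 u + P.brokenSemi (r + 1) ⊤ u with hK
  have hK0 : 0 ≤ K := by
    refine add_nonneg ?_ (P.brokenSemi_top_nonneg _ _)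
    rw [P.brokenSemi_two]
    exact Real.sqrt_nonneg _
  have hstab := hv.le_bilin_gaussTest hr hα₀ hC
  have hcons := abs_bilin_sub_interpolant_le hr hα₀ hκ hC hsol.1 huP huI w
  have hjump := hv.jumpNorm_gaussTest_le hr
  have huac := hsol.1.1.absolutelyContinuousOnInterval
  have hIac := huI.1.absolutelyContinuousOnInterval
  have hPac := hfvm.1.absolutelyContinuousOnInterval
  have hId := fun i hi j hj => huI.1.differentiableAt_gauss (i := i) (j := j) hi hj
  -- Galerkin orthogonality: `u` and `u_P` have the same values of the form on `w`, so the
  -- consistency bound becomes one for `u_I - u_P`.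
  rw [bilin_sub hr hC huac hIac (fun i hi j hj => huP.differentiableAt_gauss hi hj) hId w,
    bilin_eq_of_isSolution hr hC huP hsol w, ← hfvm.2 w, abs_sub_comm,
    ← bilin_sub hr hC hIac hPac hId (fun i hi j hj => hfvm.1.differentiableAt_gauss hi hj) w]
    at hcons
  rw [hv.normH1_eq]
  set D := ∫ x in a..b, deriv v x ^ 2 with hD
  set E := ∫ x in a..b, v x ^ 2 with hE
  have hD0 : 0 ≤ D := intervalIntegral.integral_nonneg hab.le fun x _ => sq_nonneg _
  have hE0 : 0 ≤ E := intervalIntegral.integral_nonneg hab.le fun x _ => sq_nonneg _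
  have hsqrt : Real.sqrt P.h ≤ m / (8 * M) := Real.sqrt_le_iff.mpr ⟨by positivity, hh⟩
  -- The threshold on `h` is chosen so that the quadrature error uses up at most half of the
  -- coercivity constant `m`.
  have h1 : 4 * Real.sqrt P.h * M * (D + E) ≤ m / 2 * (D + E) := by
    refine mul_le_mul_of_nonneg_right ?_ (add_nonneg hD0 hE0)
    rw [le_div_iff₀ (by positivity)] at hsqrt
    linarith
  have h2 : m * D ≤ α₀ * D := mul_le_mul_of_nonneg_right (min_le_left _ _) hD0
  have h3 : m * E ≤ κ * E := mul_le_mul_of_nonneg_right (min_le_right _ _) hE0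
  set S := Real.sqrt (D + E) with hS
  have hS0 : 0 ≤ S := Real.sqrt_nonneg _
  have hS2 : S ^ 2 = D + E := Real.sq_sqrt (add_nonneg hD0 hE0)
  have h4 : P.jumpNorm r w ≤ S := hjump.trans (Real.sqrt_le_sqrt (by linarith))
  have hpow : 0 ≤ P.h ^ (r + 1) := pow_nonneg P.h_pos.le _
  have h5 : m / 2 * S ^ 2 ≤ C₀ * P.h ^ (r + 1) * K * S := by
    have h6 := (le_abs_self _).trans (hcons.trans (mul_le_mul_of_nonneg_left h4
      (mul_nonneg (mul_nonneg hC₀0 hpow) hK0)))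
    rw [hS2]
    linarith
  rcases hS0.eq_or_lt with h0 | hpos
  · rw [← h0]
    positivity
  · have h7 : m / 2 * S ≤ C₀ * P.h ^ (r + 1) * K := by
      refine le_of_mul_le_mul_right ?_ hpos
      linarith
    have h8 : S = 2 / m * (m / 2 * S) := by field_simp
    rw [h8]
    refine (mul_le_mul_of_nonneg_left h7 (by positivity)).trans (le_of_eq ?_)
    ring

end FVM.Mesh

theorem mainTheorem4 (r : ℕ) (hr : 1 ≤ r) (a b : ℝ) (hab : a < b)
    (α₀ κ Λ : ℝ) (hα₀ : 0 < α₀) (hκ : 0 < κ) :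
    ∃ C h₀ : ℝ, 0 < C ∧ 0 < h₀ ∧
      ∀ α β γ : ℝ → ℝ, FVM.Coefficients a b α₀ κ Λ α β γ →
      ∀ P : FVM.Mesh a b,
      ∀ u uI : ℝ → ℝ, FVM.MemH10 a b u → P.MemBroken (r + 2) 2 u → P.IsInterpolant r u uI →
        (∀ w : ℕ → ℕ → ℝ,
          |P.bilin r α β γ (fun y => u y - uI y) w| ≤
            C * P.h ^ (r + 1) * (P.brokenSemi (r + 2) 2 u + P.brokenSemi (r + 1) ⊤ u) *
              P.testNorm r w) ∧
        ∀ f uP : ℝ → ℝ, P.h ≤ h₀ → FVM.IsSolution a b α β γ f u →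
          P.IsFVMSolution r α β γ f uP →
            FVM.normH1 a b (fun y => uI y - uP y) ≤
              C * P.h ^ (r + 1) * (P.brokenSemi (r + 2) 2 u + P.brokenSemi (r + 1) ⊤ u) := by
  -- For `Λ ≤ 0` there are no admissible coefficients, because `0 < α₀ ≤ α ≤ Λ` on a nonempty
  -- interval; any constants do.
  rcases le_or_gt Λ 0 with hΛ | hΛ
  · refine ⟨1, 1, one_pos, one_pos, fun α β γ hC => ?_⟩
    exact absurd (hC.upper_pos hab hα₀) hΛ.not_gt
  have hL : 0 < b - a := sub_pos.mpr hab
  have hm : 0 < min α₀ κ := lt_min hα₀ hκ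
  have hr0 : (0 : ℝ) < r := Nat.cast_pos.mpr hr
  set C₀ := Λ * (Real.sqrt r + Real.sqrt (r * (b - a)) * (3 + 5 * (b - a))) with hC₀
  have hC₀0 : 0 < C₀ := by positivity
  -- The first summand is the consistency constant, the second the same constant divided by the
  -- remaining coercivity `min α₀ κ / 2`; the sum serves both estimates.
  refine ⟨C₀ + 2 / min α₀ κ * C₀, (min α₀ κ / (8 * (Λ * Real.sqrt (b - a)))) ^ 2,
    by positivity, by positivity, fun α β γ hC P u uI hu huP huI => ?_⟩
  have hK0 : 0 ≤ P.brokenSemi (r + 2) 2 u + P.brokenSemi (r + 1) ⊤ u := by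
    refine add_nonneg ?_ (P.brokenSemi_top_nonneg _ _)
    rw [P.brokenSemi_two]
    exact Real.sqrt_nonneg _
  have hpow : 0 ≤ P.h ^ (r + 1) := pow_nonneg P.h_pos.le _
  refine ⟨fun w => ?_, fun f uP hh hsol hfvm => ?_⟩
  · refine (FVM.Mesh.abs_bilin_sub_interpolant_le hr hα₀ hκ hC hu huP huI w).trans ?_
    refine mul_le_mul ?_ (P.jumpNorm_le_testNorm w) (Real.sqrt_nonneg _) (by positivity)
    refine mul_le_mul_of_nonneg_right (mul_le_mul_of_nonneg_right ?_ hpow) hK0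
    exact le_add_of_nonneg_right (by positivity)
  · refine (FVM.Mesh.normH1_interpolant_sub_le hr hα₀ hκ hC huP huI hh hsol hfvm).trans ?_
    refine mul_le_mul_of_nonneg_right (mul_le_mul_of_nonneg_right ?_ hpow) hK0
    exact le_add_of_nonneg_left hC₀0.le
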